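/- **The code.** A block of level $0$ is a single qudit $\mathbb C^4$; a block of level $k+1$ consists of three blocks of level $k$, its children $0,1,2$ in clockwise order (indices mod $3$). The code of level $n$ is one block of level $n$; it has $N=3^n$ physical qudits and lateral size $N_0=2^n$. Each block has corners $0,1,2$ in clockwise order: corner $j$ of a block of level $k+1$ is corner $1$ (the outward corner) of its child $j$, while a single qudit is drawn as a triangle whose corners $0,1,2$ lie on its axes $3,1,2$. In every block of level $\ge 1$, corner $2$ of each child $c$ is joined to corner $0$ of the child $c+1$. The three children enclose a hole $x$, and the holes are the bulk qudits; there are $K=(3^n-1)/2$ of them. The depth of the hole of the block of level $n$ (the centre) is $0$, and that of the hole of a block of level $n-d$ is $d$, so $0\le d\le n-1$. Let $S^1,S^2,S^3$ act on the basis $|0\rangle,\dots,|3\rangle$ of $\mathbb C^4$ by the permutations $S^1=(01)(23)$, $S^2=(02)(13)$, $S^3=(03)(12)$. For each pair of joined qudits $i,i'$ let $T_{ii'}=S^{\sigma}_iS^{\sigma'}_{i'}$, where $\sigma,\sigma'$ are the axes with which $i,i'$ point to the joint; thus $T_{ii'}=S^1_iS^1_{i'}$ between different smallest three-qudit blocks,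 and $T_{ii'}=S^2_iS^3_{i'}$ clockwise inside one. Let $|\psi_m\rangle$ be the distinct basis states obtained from $|0\cdots0\rangle$ by applying finitely many $T_{ii'}$. In a qudit in state $|\alpha\rangle$, the side opposite to axis $\tau$ is dark if $\alpha\ne0$ and $\alpha\neq\tau$. The lateral of a single qudit opposite to its corner $j$ is its side opposite to that corner. The lateral of a larger block opposite to its corner $j$ is made up of the lateral of the child $j+1$ opposite to that child's corner $0$ and the lateral of the child $j-1$ opposite to that child's corner $2$. The loop around a hole $x$ consists of the laterals of its three surrounding children $0,1,2$ opposite to their corners $1$; in a state $|\psi_m\rangle$ the numbers of dark sides on these three laterals have an even sum. The label $\beta_x(\psi_m)\in(\mathbb Z/2)^2$ is the pair of parities on the laterals in the children $0$ and $1$; its four values label the basis of the bulk qudit $x$. The encoding is $$R:(\mathbb C^4)^{\otimes K}\to(\mathbb C^4)^{\otimes N},\qquad R|\beta\rangle=2^{-K/2}\sum_{m:\ \beta_y(\psi_m)=\beta_y\ \text{for all holes } y}|\psi_m\rangle ,$$ $P=RR^{+}$ is the projection onto the code space, and $\mathcal M(x)=\{R\,o_x\,R^{+}: o\in\mathbf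 L(\mathbb C^4)\}$, where $o_x$ acts as $o$ on the bulk qudit $x$ and as the identity on the others. **Prices.** A set $A$ of physical qudits recovers $\mathcal M(x)$ if each $O\in\mathcal M(x)$ can be written $O=PO_AP$ with an operator $O_A$ supported on $A$ and $[O_A,P]=0$. Put the physical qudits on a ring of length $N$ by letting the children $0,1,2$ of every block follow each other in this order; $A$ is connected if it is an arc of this ring. The price $p(x)$ is the smallest size of a set $A$ recovering $\mathcal M(x)$, and the connected price $p_c(x)$ is the smallest size of a connected such $A$. **Statement.** Let $n\ge1$ and let $x$ be a hole of depth $d$. Both minima exist, and $$p(x)=\frac{N_0}{2^d}+1,\qquad p_c(x)=\frac23\cdot\frac{N}{3^d}+1 .$$ So, from the centre outward, $p(x)=N_0+1,\ N_0/2+1,\ N_0/4+1,\dots$. Moreover, whenever $n-d\ge4$, $$\Bigl|\,p_c(x)-\frac{68}{100}\cdot\frac{N}{3^d}\Bigr|\le\frac{2}{100}\cdot\frac{68}{100}\cdot\frac{N}{3^d},$$ i.e. from the centre outward the connected price scales as about $\frac{68}{100}N,\ \frac{68}{300}N,\ \frac{68}{900}N,\dots$. -/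

import Mathlib

open scoped Matrix

/-!
The Sierpinski ququart code.  A block of level `n` consists of `3 ^ n` physical qudits.  A block of
level `n + 1` is made of three blocks of level `n`, its children `0, 1, 2`, in clockwise order.
Every block has three corners `0, 1, 2`, in clockwise order; corner `j` of a block of level `n + 1`
is the outward corner `1` of its child `j`.  Corner `2` of the child `c` is joined to corner `0` of
the next child `c + 1`.  A block of level `0` is one qudit, drawn as a triangle with its own
three corners.
-/

/-- Physical (boundary) qudits of the code with `N = 3 ^ n` qudits: the address `q` lists, from the
largest block to the smallest, the child in which the qudit lies. -/
abbrev Qudit (n : ℕ) : Type := Fin n → Fin 3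

/-- Holes of the Sierpinski lattice, i.e. bulk (logical) qudits: `none` is the central hole,
`some (a, x)` is the hole `x` of the child `a`. -/
def Hole : ℕ → Type
  | 0 => Empty
  | n + 1 => Option (Fin 3 × Hole n)

instance Hole.instFintype : (n : ℕ) → Fintype (Hole n)
  | 0 => inferInstanceAs (Fintype Empty)
  | n + 1 =>
    letI := Hole.instFintype n
    inferInstanceAs (Fintype (Option (Fin 3 × Hole n)))

instance Hole.instDecidableEq : (n : ℕ) → DecidableEq (Hole n)
  | 0 => inferInstanceAs (DecidableEq Empty)
  | n + 1 =>
    letI := Hole.instDecidableEq n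
    inferInstanceAs (DecidableEq (Option (Fin 3 × Hole n)))

/-- Depth of a hole: `0` for the central one, increasing outwards by one with each generation. -/
def Hole.depth : {n : ℕ} → Hole n → ℕ
  | 0, x => nomatch x
  | _ + 1, none => 0
  | _ + 1, some (_, x) => Hole.depth x + 1

/-- Labels of the local basis `|0⟩, |1⟩, |2⟩, |3⟩` of `ℂ⁴`, written as
`(0, 0), (1, 0), (0, 1), (1, 1)`.  With this labelling the operator
`S^σ` is `|α⟩ ↦ |α + σ⟩`; e.g. `S¹` exchanges `0 ↔ 1` and `2 ↔ 3`. -/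
abbrev Label : Type := ZMod 2 × ZMod 2

/-- Configurations `α₁, …, α_N`, indexing the product basis of the physical space `(ℂ⁴)^{⊗ N}`. -/
abbrev Config (n : ℕ) : Type := Qudit n → Label

/-- Configurations `β₁, …, β_K`, indexing the product basis of the bulk space `(ℂ⁴)^{⊗ K}`. -/
abbrev BulkConfig (n : ℕ) : Type := Hole n → Label

/-- The axis `σ` of a single qudit that points to its corner `j`.  The axes `1, 2, 3` are in
clockwise order, and the axis `1` points to the outward corner `1`. -/
def axis : Fin 3 → Label
  | 0 => (1, 1)
  | 1 => (1, 0)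
  | 2 => (0, 1)

/-- The qudit at corner `j` of a block. -/
def cornerQudit : (n : ℕ) → Fin 3 → Qudit n
  | 0, _ => Fin.elim0
  | n + 1, j => Fin.cons j (cornerQudit n 1)

/-- The axis with which the qudit at corner `j` of a block points to that corner. -/
def cornerAxis : ℕ → Fin 3 → Label
  | 0, j => axis j
  | _ + 1, _ => axis 1

/-- The gates `T_{i i'}`, one for each pair of neighbouring qudits: `gate x c` acts at the corner of
the loop around the hole `x` at which the child `c` meets the child `c + 1`.  The gate is
`|α⟩ ↦ |α + gate x c⟩`, which is `S¹ ⊗ S¹` between different smallest triangles, and `S² ⊗ S³`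
clockwise inside a smallest triangle. -/
def gate : {n : ℕ} → Hole n → Fin 3 → Config n
  | 0, x, _ => nomatch x
  | n + 1, none, c => fun q =>
      if q = Fin.cons c (cornerQudit n 2) then cornerAxis n 2
      else if q = Fin.cons (c + 1) (cornerQudit n 0) then cornerAxis n 0
      else 0
  | _ + 1, some (a, x), c => fun q =>
      if q 0 = a then gate x c (Fin.tail q) else 0

/-- The basis states `|ψ_m⟩`: those obtained from `|0⋯0⟩` by finitely many gates. -/
def IsPhysical {n : ℕ} (α : Config n) : Prop :=
  ∃ gs : List (Hole n × Fin 3), α = (gs.map fun g => gate g.1 g.2).sum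

/-- In the triangle of `|α⟩`, whether the side opposite to the corner on axis `τ` is dark:
`|0⟩` has no dark side, and `|σ⟩` has exactly the two sides that meet on the axis `σ`. -/
def IsDark (τ α : Label) : Prop := α ≠ 0 ∧ α ≠ τ

instance (τ α : Label) : Decidable (IsDark τ α) := inferInstanceAs (Decidable (_ ∧ _))

/-- The number of dark sides on the lateral of a block opposite to its corner `j`. -/
def darkCount : (n : ℕ) → Fin 3 → Config n → ℕ
  | 0, j, α => if IsDark (axis j) (α Fin.elim0) then 1 else 0
  | n + 1, j, α =>
      darkCount n 0 (fun q => α (Fin.cons (j + 1) q)) +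
      darkCount n 2 (fun q => α (Fin.cons (j - 1) q))

/-- The emergent label `β_x` read off a configuration.  The loop around `x` has one lateral in each
of the three children around `x`.  The label records the parities of the numbers of dark
sides on the laterals in the children `0` and `1`; for `|ψ_m⟩` the three parities add up to `0`,
so the label distinguishes the four possibilities, and `0` means that all three are even. -/
def pattern : {n : ℕ} → Config n → BulkConfig n
  | 0, _, x => nomatch x
  | n + 1, α, none =>
      ((darkCount n 1 (fun q => α (Fin.cons 0 q)) : ZMod 2),
        (darkCount n 1 (fun q => α (Fin.cons 1 q)) : ZMod 2))
  | _ + 1, α, some (a, x) => pattern (fun q => α (Fin.cons a q)) x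

open Classical in
/-- The encoding isometry `R : (ℂ⁴)^{⊗ K} → (ℂ⁴)^{⊗ N}`:
`R |β⟩ = 2^{-K/2} ∑ |ψ_m⟩`, over all `|ψ_m⟩` with pattern `β`. -/
noncomputable def encoding (n : ℕ) : Matrix (Config n) (BulkConfig n) ℂ :=
  Matrix.of fun α β =>
    if IsPhysical α ∧ pattern α = β then ((Real.sqrt (2 ^ Fintype.card (Hole n)) : ℂ))⁻¹ else 0

/-- The projection onto the code space, `P = R R⁺`. -/
noncomputable def codeProj (n : ℕ) : Matrix (Config n) (Config n) ℂ :=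
  encoding n * (encoding n)ᴴ

/-- Operators `O_A ⊗ 1` supported on a boundary subregion `A`. -/
def SupportedOn {n : ℕ} (A : Finset (Qudit n)) (O : Matrix (Config n) (Config n) ℂ) : Prop :=
  ∃ M : Matrix (A → Label) (A → Label) ℂ, ∀ α α' : Config n,
    ((∀ q, q ∉ A → α q = α' q) → O α α' = M (fun q => α q) (fun q => α' q)) ∧
    ((¬ ∀ q, q ∉ A → α q = α' q) → O α α' = 0)

/-- A logical operator `O` is reconstructed on `A` if `O = P O_A P` for some `O_A` supported on `A`
that commutes with `P`. -/
def Reconstructible {n : ℕ} (A : Finset (Qudit n)) (O : Matrix (Config n) (Config n) ℂ) : Prop :=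
  ∃ OA : Matrix (Config n) (Config n) ℂ, SupportedOn A OA ∧
    OA * codeProj n = codeProj n * OA ∧ O = codeProj n * OA * codeProj n

open Classical in
/-- The bulk operator `⋯ ⊗ 1 ⊗ o ⊗ 1 ⊗ ⋯` acting by `o` on the bulk qudit `x`. -/
noncomputable def bulkLocal {n : ℕ} (x : Hole n) (o : Matrix Label Label ℂ) :
    Matrix (BulkConfig n) (BulkConfig n) ℂ :=
  Matrix.of fun β β' => if ∀ y, y ≠ x → β y = β' y then o (β x) (β' x) else 0

/-- The algebra `M(x)` of logical operators of the bulk qudit `x`. -/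
def localAlgebra {n : ℕ} (x : Hole n) : Set (Matrix (Config n) (Config n) ℂ) :=
  Set.range fun o : Matrix Label Label ℂ => encoding n * bulkLocal x o * (encoding n)ᴴ

/-- `M(x)` can be reconstructed on the boundary subregion `A`. -/
def Recovers {n : ℕ} (A : Finset (Qudit n)) (x : Hole n) : Prop :=
  ∀ O ∈ localAlgebra x, Reconstructible A O

/-- Position of a qudit, in `{0, …, 3 ^ n - 1}`, on the one-dimensional boundary ring: the three
children of a block follow each other along the ring in the order `0, 1, 2`. -/
def ringPos : {n : ℕ} → Qudit n → ℕ
  | 0, _ => 0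
  | n + 1, q => (q 0 : ℕ) * 3 ^ n + ringPos (Fin.tail q)

/-- Connected boundary subregions: arcs of consecutive positions of the ring. -/
def IsConnectedRegion {n : ℕ} (A : Finset (Qudit n)) : Prop :=
  ∃ s L : ℕ, ∀ q : Qudit n, q ∈ A ↔ ∃ t < L, ringPos q = (s + t) % 3 ^ n

/-- Sizes of the boundary subregions that recover `M(x)`. -/
def recoverySizes {n : ℕ} (x : Hole n) : Set ℕ :=
  {m | ∃ A : Finset (Qudit n), Recovers A x ∧ A.card = m}

/-- Sizes of the connected boundary subregions that recover `M(x)`. -/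
def connectedRecoverySizes {n : ℕ} (x : Hole n) : Set ℕ :=
  {m | ∃ A : Finset (Qudit n), IsConnectedRegion A ∧ Recovers A x ∧ A.card = m}

/-- The price `p(x)`. -/
noncomputable def price {n : ℕ} (x : Hole n) : ℕ := sInf (recoverySizes x)

/-- The connected price `p_c(x)`. -/
noncomputable def connectedPrice {n : ℕ} (x : Hole n) : ℕ := sInf (connectedRecoverySizes x)

/-! Labels add in `(ZMod 2)²`, every gate is a translation, and every lateral parity is additive.
Hence the physical configurations form a group, a gate shifts the label of its own hole and no other
(`pattern_gate`), and on physical configurations lateral parities depend only on the labels.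
Recovery of `x` therefore has two obstructions: `A` must meet every physical configuration that
shifts the label of `x` (`not_recovers_of_shift`) and every set of qudits from which a nontrivial
parity of that label can be read (`not_recovers_of_phase`). Conversely, reading the label and
performing its shifts inside `A` suffices (`recovers_of_label`).

A `Frame` reduces everything to the block centred at `x`, with three children of level `k = n - d -
1`. A gate is a pair of corner excitations, and fewer than `2 ^ k` qudits of a child cannot prevent
a corner excitation from being moved off `A` (`exists_deformed_corner`). So each of the three joints
has an adjacent child with at least `2 ^ k` qudits of `A`; this forces two such children, and the
third still needs one qudit to meet its lateral. Two laterals and one further corner attain `2 * 2 ^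
k + 1`.

For arcs, the laterals may also be deformed to one side of a corner (`exists_lat_eq_of_ge`,
`exists_lat_eq_of_le`). Together with the joints these deformations force length `2 * 3 ^ k + 1`,
and the arc from corner `0` of child `0` to corner `0` of child `2` attains it. -/

variable {n : ℕ}

/-! ### Holes -/

/-- The central hole. -/
def Hole.center : Hole (n + 1) := (none : Option (Fin 3 × Hole n))

/-- The hole `x` of the child `a`. -/
def Hole.inner (a : Fin 3) (x : Hole n) : Hole (n + 1) := (some (a, x) : Option (Fin 3 × Hole n))

@[elab_as_elim]
theorem Hole.rec_succ {p : (n : ℕ) → Hole n → Prop} (center : ∀ n, p (n + 1) Hole.center)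
    (inner : ∀ n a x, p n x → p (n + 1) (Hole.inner a x)) : ∀ n x, p n x
  | 0, x => nomatch x
  | n + 1, none => center n
  | n + 1, some (a, x) => inner n a x (Hole.rec_succ center inner n x)

theorem Hole.eq_center_or_inner (x : Hole (n + 1)) :
    x = Hole.center ∨ ∃ a y, x = Hole.inner a y :=
  match x with
  | none => Or.inl rfl
  | some (a, y) => Or.inr ⟨a, y, rfl⟩

theorem Hole.center_ne_inner (a : Fin 3) (x : Hole n) : Hole.center ≠ Hole.inner a x :=
  fun h => Option.noConfusion rfl (heq_of_eq h)

theorem Hole.inner_inj {a b : Fin 3} {x y : Hole n} :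
    Hole.inner a x = Hole.inner b y ↔ a = b ∧ x = y := by
  constructor
  · intro h
    exact Prod.ext_iff.1 (Option.some.inj h)
  · rintro ⟨rfl, rfl⟩
    rfl

/-! ### Blocks, children and laterals -/

/-- The restriction of a configuration to the child `a`. -/
def child (a : Fin 3) (α : Config (n + 1)) : Config n := fun q => α (Fin.cons a q)

/-- The configuration `α` placed in the child `a`, with `0` in the other children. -/
def inChild (a : Fin 3) (α : Config n) : Config (n + 1) :=
  fun q => if q 0 = a then α (Fin.tail q) else 0

theorem child_inChild (a b : Fin 3) (α : Config n) :
    child b (inChild a α) = if b = a then α else 0 := by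
  funext q
  by_cases h : b = a <;> simp [child, inChild, h]

theorem child_add (a : Fin 3) (α β : Config (n + 1)) :
    child a (α + β) = child a α + child a β := rfl

theorem inChild_add (a : Fin 3) (α β : Config n) :
    inChild a (α + β) = inChild a α + inChild a β := by
  funext q
  by_cases h : q 0 = a <;> simp [inChild, h]

theorem inChild_zero (a : Fin 3) : inChild a (0 : Config n) = 0 := by
  funext q
  simp [inChild]

theorem config_add_self (α : Config n) : α + α = 0 := by
  funext q
  exact CharTwo.add_self_eq_zero (α q)

theorem label_add_self (v : Label) : v + v = 0 := CharTwo.add_self_eq_zero v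

/-- The parity of the number of dark sides on the lateral opposite to the corner `j`. -/
def lat (j : Fin 3) (α : Config n) : ZMod 2 := (darkCount n j α : ZMod 2)

theorem lat_succ (j : Fin 3) (α : Config (n + 1)) :
    lat j α = lat 0 (child (j + 1) α) + lat 2 (child (j - 1) α) := by
  simp only [lat, darkCount, Nat.cast_add]
  rfl

theorem lat_level_zero (j : Fin 3) (α : Config 0) :
    lat j α = if IsDark (axis j) (α Fin.elim0) then 1 else 0 := by
  simp only [lat, darkCount]
  split_ifs <;> simp

/-- Darkness is the indicator of the complement of the subgroup `{0, τ}`, i.e. a character of `(ZMod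
2)²`. All linearity below comes from this. -/
theorem dark_parity_add : ∀ (j : Fin 3) (v w : Label),
    (if IsDark (axis j) (v + w) then (1 : ZMod 2) else 0) =
      (if IsDark (axis j) v then 1 else 0) + if IsDark (axis j) w then 1 else 0 := by
  decide

theorem lat_add (j : Fin 3) (α β : Config n) : lat j (α + β) = lat j α + lat j β := by
  induction n generalizing j with
  | zero =>
    simp only [lat_level_zero]
    exact dark_parity_add j _ _
  | succ n ih =>
    simp only [lat_succ, child_add, ih]
    ring

theorem lat_zero (j : Fin 3) : lat j (0 : Config n) = 0 := by
  simpa using lat_add j (0 : Config n) 0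

/-- The excitation of the single qudit at the corner `j` along its outward axis. -/
def corner (n : ℕ) (j : Fin 3) : Config n := Pi.single (cornerQudit n j) (cornerAxis n j)

theorem cornerAxis_one (n : ℕ) : cornerAxis n 1 = axis 1 := by
  cases n <;> rfl

theorem inChild_single (a : Fin 3) (q : Qudit n) (v : Label) :
    inChild a (Pi.single q v) = Pi.single (Fin.cons a q : Qudit (n + 1)) v := by
  funext p
  induction p using Fin.consCases with
  | _ b p =>
    by_cases h : b = a
    · by_cases h' : p = q <;> simp [inChild, h, h']
    · have : (Fin.cons b p : Qudit (n + 1)) ≠ Fin.cons a q := by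
        intro e
        exact h (Fin.cons_inj.1 e).1
      simp [inChild, h]

theorem corner_succ (n : ℕ) (j : Fin 3) : corner (n + 1) j = inChild j (corner n 1) := by
  rw [corner, corner, inChild_single, cornerAxis_one]
  rfl

/-- Splitting a gate into two corner excitations allows each half to be deformed separately within
its own child. -/
theorem gate_center (n : ℕ) (c : Fin 3) :
    gate (n := n + 1) Hole.center c = inChild c (corner n 2) + inChild (c + 1) (corner n 0) := by
  rw [corner, corner, inChild_single, inChild_single]
  have hc : c ≠ c + 1 := by
    revert c
    decide
  funext q
  simp only [gate, Hole.center, Pi.add_apply, Pi.single_apply]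
  by_cases h : q = Fin.cons c (cornerQudit n 2)
  · have : q ≠ Fin.cons (c + 1) (cornerQudit n 0) := by
      rw [h]
      intro e
      exact hc (Fin.cons_inj.1 e).1
    simp [h, hc]
  · simp [h]

theorem gate_inner (a : Fin 3) (x : Hole n) (c : Fin 3) :
    gate (Hole.inner a x) c = inChild a (gate x c) := rfl

theorem lat_corner (i j : Fin 3) : lat i (corner n j) = if i = j then 0 else 1 := by
  induction n generalizing i j with
  | zero =>
    have : corner 0 j Fin.elim0 = axis j := by
      rw [corner, Subsingleton.elim (cornerQudit 0 j) Fin.elim0]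
      simp [cornerAxis]
    rw [lat_level_zero, this]
    revert i j
    decide
  | succ n ih =>
    have key : ∀ (b i : Fin 3), lat i (if b = j then corner n 1 else 0) =
        if b = j then (if i = 1 then 0 else 1) else 0 := by
      intro b i
      split_ifs with h1 h2 <;> simp [lat_zero, *]
    rw [corner_succ, lat_succ, child_inChild, child_inChild, key, key]
    clear key ih
    revert i j
    decide

/-! ### Physical configurations -/

theorem IsPhysical.zero : IsPhysical (0 : Config n) := ⟨[], rfl⟩

theorem IsPhysical.add {α β : Config n} (hα : IsPhysical α) (hβ : IsPhysical β) :
    IsPhysical (α + β) := by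
  obtain ⟨l, rfl⟩ := hα
  obtain ⟨l', rfl⟩ := hβ
  exact ⟨l ++ l', by simp⟩

theorem isPhysical_gate (x : Hole n) (c : Fin 3) : IsPhysical (gate x c) :=
  ⟨[(x, c)], by simp⟩

theorem IsPhysical.induction {p : Config n → Prop} (h0 : p 0)
    (hg : ∀ x c, p (gate x c)) (hadd : ∀ α β, p α → p β → p (α + β)) {α : Config n}
    (hα : IsPhysical α) : p α := by
  obtain ⟨l, rfl⟩ := hα
  induction l with
  | nil => exact h0
  | cons g l ih => exact hadd _ _ (hg _ _) ih

theorem IsPhysical.inChild {α : Config n} (a : Fin 3) (hα : IsPhysical α) :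
    IsPhysical (inChild a α) := by
  refine IsPhysical.induction (p := fun α => IsPhysical (_root_.inChild a α)) ?_ ?_ ?_ hα
  · rw [inChild_zero]
    exact .zero
  · intro x c
    exact isPhysical_gate (Hole.inner a x) c
  · intro α β hα hβ
    rw [inChild_add]
    exact hα.add hβ

/-- All loops around the holes carry an even number of dark sides. -/
def EvenLoops : {n : ℕ} → Config n → Prop
  | 0, _ => True
  | _ + 1, α => lat 1 (child 0 α) + lat 1 (child 1 α) + lat 1 (child 2 α) = 0 ∧
      ∀ a, EvenLoops (child a α)

theorem EvenLoops.zero : EvenLoops (0 : Config n) := by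
  induction n with
  | zero => trivial
  | succ n ih =>
    have : ∀ a, child a (0 : Config (n + 1)) = 0 := fun a => rfl
    simp only [EvenLoops, this, lat_zero]
    exact ⟨by simp, fun _ => ih⟩

theorem EvenLoops.add {α β : Config n} (hα : EvenLoops α) (hβ : EvenLoops β) :
    EvenLoops (α + β) := by
  induction n with
  | zero => trivial
  | succ n ih =>
    refine ⟨?_, fun a => ih (hα.2 a) (hβ.2 a)⟩
    simp only [child_add, lat_add]
    linear_combination hα.1 + hβ.1

theorem EvenLoops.inChild {α : Config n} (a : Fin 3) (h1 : lat 1 α = 0) (hα : EvenLoops α) :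
    EvenLoops (inChild a α) := by
  have key : ∀ b, lat 1 (child b (_root_.inChild a α)) = 0 := by
    intro b
    rw [child_inChild]
    split_ifs
    exacts [h1, lat_zero 1]
  refine ⟨by simp [key], fun b => ?_⟩
  rw [child_inChild]
  split_ifs
  exacts [hα, .zero]

theorem evenLoops_corner (n : ℕ) (j : Fin 3) : EvenLoops (corner n j) := by
  induction n generalizing j with
  | zero => trivial
  | succ n ih =>
    rw [corner_succ]
    exact (ih 1).inChild j (by simp [lat_corner])

/-- The two halves of a central gate each flip one side of the same outer lateral, the one opposite
to corner `c - 1`, and the flips cancel. -/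
theorem lat_gate (j : Fin 3) (x : Hole n) (c : Fin 3) : lat j (gate x c) = 0 := by
  induction n generalizing j c with
  | zero => exact nomatch x
  | succ n ih =>
    have key : ∀ (b a i j : Fin 3), lat i (if b = a then corner n j else 0) =
        if b = a then (if i = j then 0 else 1) else 0 := by
      intro b a i j
      split_ifs with h1 h2 <;> simp [lat_corner, lat_zero, *]
    obtain rfl | ⟨a, x, rfl⟩ := x.eq_center_or_inner
    · rw [gate_center, lat_add, lat_succ, lat_succ]
      simp only [child_inChild, key]
      clear key ih
      revert j c
      decide
    · rw [gate_inner, lat_succ, child_inChild, child_inChild]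
      split_ifs <;> simp [ih, lat_zero]

theorem IsPhysical.lat_eq_zero {α : Config n} (j : Fin 3) (hα : IsPhysical α) : lat j α = 0 :=
  IsPhysical.induction (p := fun α => lat j α = 0) (lat_zero j) (fun x c => lat_gate j x c)
    (fun α β hα hβ => by rw [lat_add, hα, hβ, add_zero]) hα

theorem evenLoops_gate (x : Hole n) (c : Fin 3) : EvenLoops (gate x c) := by
  induction n with
  | zero => exact nomatch x
  | succ n ih =>
    obtain rfl | ⟨a, x, rfl⟩ := x.eq_center_or_inner
    · rw [gate_center]
      refine ⟨?_, fun b => ?_⟩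
      · have key : ∀ (b a j : Fin 3), lat 1 (if b = a then corner n j else 0) =
            if b = a then (if 1 = j then 0 else 1) else 0 := by
          intro b a j
          split_ifs with h1 h2 <;> simp [lat_corner, lat_zero, *]
        simp only [child_add, lat_add, child_inChild, key]
        clear key ih
        revert c
        decide
      · rw [child_add, child_inChild, child_inChild]
        refine EvenLoops.add ?_ ?_ <;> split_ifs
        exacts [evenLoops_corner n 2, .zero, evenLoops_corner n 0, .zero]
    · exact (ih x).inChild a (lat_gate 1 x c)

/-- Restriction to a child destroys physicality, since a gate may leave a lone corner excitation
there, but it keeps loops even. Deformations of laterals therefore rest on `EvenLoops`. -/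
theorem IsPhysical.evenLoops {α : Config n} (hα : IsPhysical α) : EvenLoops α :=
  IsPhysical.induction .zero evenLoops_gate (fun _ _ => .add) hα

/-- The outer boundary consists of laterals `0` and `2` of each child; by induction these may be
traded for the laterals `1`, which form the central loop. -/
theorem EvenLoops.lat_sum {α : Config n} (hα : EvenLoops α) : lat 0 α + lat 1 α + lat 2 α = 0 := by
  induction n with
  | zero =>
    simp only [lat_level_zero]
    generalize α Fin.elim0 = v
    revert v
    decide
  | succ n ih =>
    have e : ∀ j, lat j α = lat 0 (child (j + 1) α) + lat 2 (child (j - 1) α) := fun j => lat_succ j α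
    have h0 := ih (hα.2 0)
    have h1 := ih (hα.2 1)
    have h2 := ih (hα.2 2)
    have h := hα.1
    have t : (2 : ZMod 2) = 0 := rfl
    rw [e 0, e 1, e 2]
    simp only [show (0 : Fin 3) + 1 = 1 from rfl, show (1 : Fin 3) + 1 = 2 from rfl,
      show (2 : Fin 3) + 1 = 0 from rfl, show (0 : Fin 3) - 1 = 2 from rfl,
      show (1 : Fin 3) - 1 = 0 from rfl, show (2 : Fin 3) - 1 = 1 from rfl]
    linear_combination h0 + h1 + h2 - h

/-! ### Patterns -/

theorem pattern_center (α : Config (n + 1)) :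
    pattern α Hole.center = (lat 1 (child 0 α), lat 1 (child 1 α)) := rfl

theorem pattern_inner (α : Config (n + 1)) (a : Fin 3) (x : Hole n) :
    pattern α (Hole.inner a x) = pattern (child a α) x := rfl

theorem pattern_add (α β : Config n) : pattern (α + β) = pattern α + pattern β := by
  funext x
  rw [Pi.add_apply]
  induction n, x using Hole.rec_succ with
  | center n =>
    simp only [pattern_center, child_add, lat_add]
    rfl
  | inner n a x ih => rw [pattern_inner, child_add, ih, ← pattern_inner, ← pattern_inner]

theorem pattern_zero : pattern (0 : Config n) = 0 := by
  simpa using pattern_add (0 : Config n) 0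

theorem pattern_corner (n : ℕ) (j : Fin 3) : pattern (corner n j) = 0 := by
  funext x
  rw [Pi.zero_apply]
  induction n, x using Hole.rec_succ generalizing j with
  | center n =>
    rw [corner_succ, pattern_center, child_inChild, child_inChild]
    split_ifs <;> simp [lat_corner, lat_zero]
  | inner n a x ih =>
    rw [corner_succ, pattern_inner, child_inChild]
    split_ifs
    · exact ih 1
    · rw [pattern_zero, Pi.zero_apply]

/-- The label of the bulk shift performed by the gate at the joint between the children `c`
and `c + 1`. -/
def gateLabel : Fin 3 → Label
  | 0 => (1, 1)
  | 1 => (0, 1)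
  | 2 => (1, 0)

theorem pattern_gate (x y : Hole n) (c : Fin 3) :
    pattern (gate x c) y = if y = x then gateLabel c else 0 := by
  induction n with
  | zero => exact nomatch x
  | succ n ih =>
    obtain rfl | ⟨b, x, rfl⟩ := x.eq_center_or_inner <;>
      obtain rfl | ⟨a, y, rfl⟩ := y.eq_center_or_inner
    · have key : ∀ (b a j : Fin 3), lat 1 (if b = a then corner n j else 0) =
          if b = a then (if 1 = j then 0 else 1) else 0 := by
        intro b a j
        split_ifs with h1 h2 <;> simp [lat_corner, lat_zero, *]
      rw [gate_center, pattern_center, if_pos rfl]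
      simp only [child_add, lat_add, child_inChild, key]
      clear key ih
      revert c
      decide
    · rw [gate_center, pattern_inner, child_add, pattern_add, child_inChild, child_inChild,
        if_neg (Hole.center_ne_inner a y).symm]
      split_ifs <;> simp [pattern_corner, pattern_zero]
    · rw [gate_inner, pattern_center, child_inChild, child_inChild,
        if_neg (Hole.center_ne_inner b x)]
      split_ifs <;> simp [lat_gate, lat_zero]
    · rw [gate_inner, pattern_inner, child_inChild]
      by_cases h : a = b
      · rw [if_pos h, ih]
        simp [Hole.inner_inj, h]
      · rw [if_neg h, pattern_zero, if_neg (fun h' => h (Hole.inner_inj.1 h').1)]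
        rfl

/-! ### Strings of excitations -/

/-- Adding the inductive configurations of the three children and the three central gates cancels
every inner corner. Modulo physical configurations, one corner thus equals the sum of the other two.
-/
theorem corner_sum_isPhysical (n : ℕ) : IsPhysical (corner n 0 + corner n 1 + corner n 2) := by
  induction n with
  | zero =>
    have : corner 0 0 + corner 0 1 + corner 0 2 = 0 := by
      funext q
      have e : ∀ j, corner 0 j q = axis j := by
        intro j
        rw [corner, Subsingleton.elim (cornerQudit 0 j) q]
        simp [cornerAxis]
      simp only [Pi.add_apply, e]
      clear * -
      decide +revert
    rw [this]
    exact .zero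
  | succ n ih =>
    have h : ∀ c, IsPhysical (inChild c (corner n 0 + corner n 1 + corner n 2)) :=
      fun c => ih.inChild c
    have g : ∀ c, IsPhysical (inChild c (corner n 2) + inChild (c + 1) (corner n 0)) := by
      intro c
      rw [← gate_center]
      exact isPhysical_gate (n := n + 1) Hole.center c
    have := (((h 0).add (h 1)).add (h 2)).add (((g 0).add (g 1)).add (g 2))
    simp only [corner_succ]
    simp only [inChild_add] at this
    convert this using 1
    have d := fun c => config_add_self (inChild c (corner n 0))
    have d' := fun c => config_add_self (inChild c (corner n 2))
    simp only [show (0 : Fin 3) + 1 = 1 from rfl, show (1 : Fin 3) + 1 = 2 from rfl,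
      show (2 : Fin 3) + 1 = 0 from rfl]
    linear_combination (-1 : ℤ) • (d 0 + d 1 + d 2 + d' 0 + d' 1 + d' 2)

theorem sum_card_preimage_le {k n : ℕ} (f : Fin 3 → Qudit k → Qudit n)
    (hf : ∀ c q c' q', f c q = f c' q' → c = c' ∧ q = q') (A : Finset (Qudit n)) :
    ∑ c, (Finset.univ.filter fun q => f c q ∈ A).card ≤ A.card := by
  rw [← Finset.card_sigma]
  refine Finset.card_le_card_of_injOn (fun p => f p.1 p.2) ?_ ?_
  · rintro ⟨c, q⟩ h
    simpa using h
  · rintro ⟨c, q⟩ _ ⟨c', q'⟩ _ h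
    obtain ⟨rfl, rfl⟩ := hf _ _ _ _ h
    rfl

/-- A region with fewer than `2 ^ n` qudits cannot cut a corner off: an excitation of the corner
can be deformed into a configuration outside the region. -/
theorem exists_deformed_corner (A : Finset (Qudit n)) (hA : A.card < 2 ^ n) (j : Fin 3) :
    ∃ s : Config n, (∀ q ∈ A, s q = 0) ∧ IsPhysical (s + corner n j) := by
  induction n generalizing j with
  | zero =>
    have : A = ∅ := by
      rw [← Finset.card_eq_zero]
      simpa using hA
    refine ⟨corner 0 j, by simp [this], ?_⟩
    rw [config_add_self]
    exact .zero
  | succ n ih =>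
    let B : Fin 3 → Finset (Qudit n) := fun a => Finset.univ.filter fun q => Fin.cons a q ∈ A
    have hB : (B 0).card + (B 1).card + (B 2).card ≤ A.card := by
      have := sum_card_preimage_le (fun (a : Fin 3) (q : Qudit n) => (Fin.cons a q : Qudit (n + 1)))
        (fun c q c' q' h => Fin.cons_inj.1 h) A
      rwa [Fin.sum_univ_three] at this
    have lift : ∀ a, (B a).card < 2 ^ n → ∃ s : Config (n + 1), (∀ q ∈ A, s q = 0) ∧
        IsPhysical (s + corner (n + 1) a) := by
      intro a ha
      obtain ⟨s, hs, hp⟩ := ih (B a) ha 1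
      refine ⟨inChild a s, fun q hq => ?_, ?_⟩
      · by_cases h : q 0 = a
        · rw [inChild, if_pos h]
          refine hs _ ?_
          simp only [B, Finset.mem_filter, Finset.mem_univ, true_and]
          rwa [← h, Fin.cons_self_tail]
        · rw [inChild, if_neg h]
      · rw [corner_succ, ← inChild_add]
        exact hp.inChild a
    -- Either the excitation is deformed inside child `j`, or that child uses up half the bound and
    -- both other children are sparse.
    by_cases hj : (B j).card < 2 ^ n
    · exact lift j hj
    · have h1 : (B (j + 1)).card < 2 ^ n ∧ (B (j + 2)).card < 2 ^ n := by
        rw [pow_succ] at hA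
        fin_cases j <;> simp at hj ⊢ <;> omega
      obtain ⟨s, hs, hp⟩ := lift _ h1.1
      obtain ⟨t, ht, hq⟩ := lift _ h1.2
      refine ⟨s + t, fun q hq => by simp [hs q hq, ht q hq], ?_⟩
      -- Corner `j` is exchanged for the other two corners, which have already been deformed.
      have e : s + t + corner (n + 1) j = (s + corner (n + 1) (j + 1)) +
          (t + corner (n + 1) (j + 2)) +
          (corner (n + 1) 0 + corner (n + 1) 1 + corner (n + 1) 2) := by
        have e' : corner (n + 1) 0 + corner (n + 1) 1 + corner (n + 1) 2 =
            corner (n + 1) j + corner (n + 1) (j + 1) + corner (n + 1) (j + 2) := by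
          clear * -
          fin_cases j
          · rfl
          · change _ = corner (n + 1) 1 + corner (n + 1) 2 + corner (n + 1) 0
            abel
          · change _ = corner (n + 1) 2 + corner (n + 1) 0 + corner (n + 1) 1
            abel
        rw [e']
        have d1 := config_add_self (corner (n + 1) (j + 1))
        have d2 := config_add_self (corner (n + 1) (j + 2))
        linear_combination (-1 : ℤ) • (d1 + d2)
      rw [e]
      exact (hp.add hq).add (corner_sum_isPhysical (n + 1))

/-! ### Positions and arcs on the ring -/

theorem ringPos_cons (a : Fin 3) (q : Qudit n) :
    ringPos (Fin.cons a q : Qudit (n + 1)) = a * 3 ^ n + ringPos q := by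
  simp [ringPos]

theorem ringPos_lt (q : Qudit n) : ringPos q < 3 ^ n := by
  induction n with
  | zero => simp [ringPos]
  | succ n ih =>
    have h := ih (Fin.tail q)
    have h0 : (q 0 : ℕ) ≤ 2 := by omega
    have : (q 0 : ℕ) * 3 ^ n ≤ 2 * 3 ^ n := Nat.mul_le_mul_right _ h0
    rw [ringPos, pow_succ]
    omega

theorem ringPos_injective : Function.Injective (ringPos (n := n)) := by
  induction n with
  | zero => exact Function.injective_of_subsingleton _
  | succ n ih =>
    intro q p h
    simp only [ringPos] at h
    have hq := ringPos_lt (Fin.tail q)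
    have hp := ringPos_lt (Fin.tail p)
    have pos : 0 < 3 ^ n := by positivity
    have h1 : q 0 = p 0 := by
      have := congrArg (· / 3 ^ n) h
      simp only [mul_comm _ (3 ^ n), Nat.mul_add_div pos, Nat.div_eq_of_lt hq,
        Nat.div_eq_of_lt hp, add_zero] at this
      exact Fin.ext this
    have h2 : Fin.tail q = Fin.tail p := by
      rw [h1] at h
      exact ih (by omega)
    rw [← Fin.cons_self_tail q, ← Fin.cons_self_tail p, h1, h2]

theorem exists_ringPos_eq {m : ℕ} (hm : m < 3 ^ n) : ∃ q : Qudit n, ringPos q = m := by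
  have inj : Function.Injective fun q : Qudit n => (⟨ringPos q, ringPos_lt q⟩ : Fin (3 ^ n)) :=
    fun q p h => ringPos_injective (by simpa using h)
  have bij := (Fintype.bijective_iff_injective_and_card _).2 ⟨inj, by simp⟩
  obtain ⟨q, hq⟩ := bij.2 ⟨m, hm⟩
  exact ⟨q, by simpa using hq⟩

theorem card_interval {l r : ℕ} (hr : r ≤ 3 ^ n) :
    (Finset.univ.filter fun q : Qudit n => l ≤ ringPos q ∧ ringPos q < r).card = r - l := by
  rw [← Nat.card_Ico]
  refine Finset.card_bij (fun q _ => ringPos q) ?_ ?_ ?_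
  · intro q hq
    simpa using hq
  · intro q _ p _ h
    exact ringPos_injective h
  · intro m hm
    rw [Finset.mem_Ico] at hm
    obtain ⟨q, rfl⟩ := exists_ringPos_eq (hm.2.trans_le hr)
    exact ⟨q, by simpa using hm, rfl⟩

/-- A connected region is an interval of positions or the complement of one. -/
theorem IsConnectedRegion.cases {A : Finset (Qudit n)} (hA : IsConnectedRegion A) :
    ∃ l r : ℕ, l ≤ r ∧ r ≤ 3 ^ n ∧
      ((A.card = r - l ∧ ∀ q, q ∈ A ↔ l ≤ ringPos q ∧ ringPos q < r) ∨
        (A.card = 3 ^ n - (r - l) ∧ ∀ q, q ∈ A ↔ ¬(l ≤ ringPos q ∧ ringPos q < r))) := by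
  obtain ⟨s, L, h⟩ := hA
  have pos : 0 < 3 ^ n := by positivity
  obtain ⟨u, hu⟩ : ∃ u, u = s % 3 ^ n := ⟨_, rfl⟩
  have hul : u < 3 ^ n := hu ▸ Nat.mod_lt _ pos
  have h' : ∀ q, q ∈ A ↔ ∃ t < L, ringPos q = (u + t) % 3 ^ n := by
    intro q
    rw [h, hu]
    simp
  have interval : ∀ l r, r ≤ 3 ^ n → (∀ q, q ∈ A ↔ l ≤ ringPos q ∧ ringPos q < r) →
      A.card = r - l := by
    intro l r hr hq
    rw [← card_interval hr]
    congr 1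
    ext q
    simp [hq]
  by_cases hL : 3 ^ n ≤ L
  · have all : ∀ q, q ∈ A ↔ 0 ≤ ringPos q ∧ ringPos q < 3 ^ n := by
      intro q
      refine ⟨fun _ => ⟨zero_le, ringPos_lt q⟩, fun _ => (h' q).2 ?_⟩
      have := ringPos_lt q
      by_cases hq : u ≤ ringPos q
      · exact ⟨ringPos q - u, by omega, by
          rw [Nat.add_sub_cancel' hq, Nat.mod_eq_of_lt this]⟩
      · exact ⟨ringPos q + 3 ^ n - u, by omega, by
          rw [Nat.add_sub_cancel' (by omega), Nat.add_mod_right, Nat.mod_eq_of_lt this]⟩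
    exact ⟨0, 3 ^ n, by omega, le_rfl, Or.inl ⟨interval _ _ le_rfl all, all⟩⟩
  by_cases hw : u + L ≤ 3 ^ n
  · have all : ∀ q, q ∈ A ↔ u ≤ ringPos q ∧ ringPos q < u + L := by
      intro q
      rw [h']
      constructor
      · rintro ⟨t, ht, e⟩
        rw [Nat.mod_eq_of_lt (by omega)] at e
        omega
      · intro hq
        exact ⟨ringPos q - u, by omega, by
          rw [Nat.add_sub_cancel' hq.1, Nat.mod_eq_of_lt (ringPos_lt q)]⟩
    exact ⟨u, u + L, by omega, hw, Or.inl ⟨interval _ _ hw all, all⟩⟩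
  -- The arc passes position `0`, so what it misses is an interval.
  · have all : ∀ q, q ∈ A ↔ ¬(u + L - 3 ^ n ≤ ringPos q ∧ ringPos q < u) := by
      intro q
      have := ringPos_lt q
      rw [h']
      constructor
      · rintro ⟨t, ht, e⟩
        by_cases htu : u + t < 3 ^ n
        · rw [Nat.mod_eq_of_lt htu] at e
          omega
        · rw [Nat.mod_eq_sub_mod (by omega), Nat.mod_eq_of_lt (by omega)] at e
          omega
      · intro hq
        by_cases hq' : u ≤ ringPos q
        · exact ⟨ringPos q - u, by omega, by
            rw [Nat.add_sub_cancel' hq', Nat.mod_eq_of_lt this]⟩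
        · exact ⟨ringPos q + 3 ^ n - u, by omega, by
            rw [Nat.add_sub_cancel' (by omega), Nat.add_mod_right, Nat.mod_eq_of_lt this]⟩
    refine ⟨u + L - 3 ^ n, u, by omega, hul.le, Or.inr ⟨?_, all⟩⟩
    have e : A = (Finset.univ.filter fun q : Qudit n =>
        u + L - 3 ^ n ≤ ringPos q ∧ ringPos q < u)ᶜ := by
      ext q
      simp [all]
    have hcard := card_interval (n := n) (l := u + L - 3 ^ n) hul.le
    rw [e, Finset.card_compl, hcard]
    simp

/-! ### The encoding -/

/-- The amplitude `2 ^ (-K / 2)` of the encoding. -/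
noncomputable def amplitude (n : ℕ) : ℂ := ((Real.sqrt (2 ^ Fintype.card (Hole n)) : ℂ))⁻¹

theorem amplitude_ne_zero (n : ℕ) : amplitude n ≠ 0 := by
  refine inv_ne_zero (Complex.ofReal_ne_zero.2 ?_)
  positivity

theorem star_amplitude (n : ℕ) : star (amplitude n) = amplitude n := by
  simp [amplitude]

open Classical in
theorem encoding_apply (α : Config n) (β : BulkConfig n) :
    encoding n α β = if IsPhysical α ∧ pattern α = β then amplitude n else 0 := rfl

open Classical in
theorem encoding_mul_apply {ι : Type*} (M : Matrix (BulkConfig n) ι ℂ) (α : Config n) (j : ι) :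
    (encoding n * M) α j = if IsPhysical α then amplitude n * M (pattern α) j else 0 := by
  rw [Matrix.mul_apply]
  by_cases h : IsPhysical α <;> simp [encoding_apply, h]

open Classical in
theorem encoding_conj_apply (M : Matrix (BulkConfig n) (BulkConfig n) ℂ) (α α' : Config n) :
    (encoding n * M * (encoding n)ᴴ) α α' =
      if IsPhysical α ∧ IsPhysical α' then
        amplitude n * amplitude n * M (pattern α) (pattern α') else 0 := by
  rw [Matrix.mul_assoc, encoding_mul_apply, Matrix.mul_apply]
  by_cases h : IsPhysical α <;> by_cases h' : IsPhysical α' <;>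
    simp [-Complex.star_def, Matrix.conjTranspose_apply, encoding_apply, apply_ite star, h, h',
      star_amplitude]
  ring

open Classical in
theorem codeProj_apply (α α' : Config n) :
    codeProj n α α' = if IsPhysical α ∧ IsPhysical α' ∧ pattern α = pattern α' then
      amplitude n * amplitude n else 0 := by
  have := encoding_conj_apply (n := n) 1 α α'
  rw [Matrix.mul_one] at this
  rw [codeProj, this]
  simp only [Matrix.one_apply, mul_ite, mul_one, mul_zero, ← ite_and, and_assoc]

/-! ### Obstructions to recovery -/

theorem IsPhysical.of_add {α g : Config n} (hg : IsPhysical g) (h : IsPhysical (α + g)) :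
    IsPhysical α := by
  have := h.add hg
  rwa [add_assoc, config_add_self, add_zero] at this

theorem IsPhysical.add_iff {α g : Config n} (hg : IsPhysical g) :
    IsPhysical (α + g) ↔ IsPhysical α := ⟨hg.of_add, fun h => h.add hg⟩

theorem codeProj_add {g : Config n} (hg : IsPhysical g) (α α' : Config n) :
    codeProj n (α + g) (α' + g) = codeProj n α α' := by
  classical
  rw [codeProj_apply, codeProj_apply]
  refine if_congr ?_ rfl rfl
  rw [hg.add_iff, hg.add_iff, pattern_add, pattern_add, add_left_inj]

theorem SupportedOn.add {A : Finset (Qudit n)} {O : Matrix (Config n) (Config n) ℂ}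
    (hO : SupportedOn A O) {g : Config n} (hg : ∀ q ∈ A, g q = 0) (α α' : Config n) :
    O (α + g) (α' + g) = O α α' := by
  obtain ⟨M, hM⟩ := hO
  by_cases h : ∀ q, q ∉ A → α q = α' q
  · have h' : ∀ q, q ∉ A → (α + g) q = (α' + g) q := fun q hq => by
      rw [Pi.add_apply, Pi.add_apply, h q hq]
    rw [(hM _ _).1 h, (hM _ _).1 h']
    congr 1 <;> funext q <;> simp [hg q q.2]
  · have h' : ¬∀ q, q ∉ A → (α + g) q = (α' + g) q := fun h' =>
      h fun q hq => by simpa using h' q hq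
    rw [(hM _ _).2 h, (hM _ _).2 h']

theorem SupportedOn.eq_off {A : Finset (Qudit n)} {O : Matrix (Config n) (Config n) ℂ}
    (hO : SupportedOn A O) {α α' : Config n} (h : O α α' ≠ 0) : ∀ q, q ∉ A → α q = α' q := by
  obtain ⟨M, hM⟩ := hO
  by_contra h'
  exact h ((hM _ _).2 h')

/-- A region that misses a logical shift of the bulk qudit `x` does not recover `x`. -/
theorem not_recovers_of_shift {A : Finset (Qudit n)} {x : Hole n} {g : Config n}
    (hg : IsPhysical g) (hA : ∀ q ∈ A, g q = 0) (hx : pattern g x ≠ 0) : ¬Recovers A x := by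
  intro hrec
  obtain ⟨OA, hsupp, -, hO⟩ := hrec (encoding n * bulkLocal x (Matrix.single 0 0 1) * (encoding n)ᴴ) ⟨_, rfl⟩
  have inv : ∀ α α', (codeProj n * OA * codeProj n) (α + g) (α' + g) =
      (codeProj n * OA * codeProj n) α α' := by
    intro α α'
    simp only [Matrix.mul_apply]
    rw [← Equiv.sum_comp (Equiv.addRight g)]
    refine Finset.sum_congr rfl fun γ _ => ?_
    rw [← Equiv.sum_comp (Equiv.addRight g)]
    simp only [Equiv.coe_addRight, codeProj_add hg, hsupp.add hA]
  -- The projector onto label `0` has a nonzero diagonal entry at `0` but none at `g`, which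
  -- contradicts invariance under `g`.
  have e := inv 0 0
  rw [← hO, encoding_conj_apply, encoding_conj_apply] at e
  simp [hg, IsPhysical.zero, pattern_zero, bulkLocal, amplitude_ne_zero, hx.symm] at e

/-- A region that misses a logical phase of the bulk qudit `x` does not recover `x`. -/
theorem not_recovers_of_phase {A : Finset (Qudit n)} {x : Hole n} {g : Config n}
    (hg : IsPhysical g) (hx : ∀ y, y ≠ x → pattern g y = 0) (f : Config n → ZMod 2)
    (hf : ∀ α α', (∀ q, q ∉ A → α q = α' q) → f α = f α')
    (hp : ∀ α α', IsPhysical α → IsPhysical α' → pattern α = pattern α' → f α = f α')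
    (hfg : f g ≠ f 0) : ¬Recovers A x := by
  intro hrec
  obtain ⟨OA, hsupp, -, hO⟩ := hrec
    (encoding n * bulkLocal x (Matrix.single (pattern g x) 0 1) * (encoding n)ᴴ) ⟨_, rfl⟩
  have hP : ∀ α α', codeProj n α α' ≠ 0 → f α = f α' := by
    classical
    intro α α' h
    rw [codeProj_apply] at h
    obtain ⟨h, -⟩ := ite_ne_right_iff.1 h
    exact hp _ _ h.1 h.2.1 h.2.2
  -- Neither `OA`, which changes only qudits of `A`, nor the projection changes `f`; yet the chosen
  -- logical operator has a nonzero entry between `0` and `g`.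
  have key : (codeProj n * OA * codeProj n) g 0 ≠ 0 → f g = f 0 := by
    intro h
    rw [Matrix.mul_apply] at h
    obtain ⟨γ, -, h⟩ := Finset.exists_ne_zero_of_sum_ne_zero h
    obtain ⟨h1, h2⟩ := mul_ne_zero_iff.1 h
    rw [Matrix.mul_apply] at h1
    obtain ⟨δ, -, h⟩ := Finset.exists_ne_zero_of_sum_ne_zero h1
    obtain ⟨h3, h4⟩ := mul_ne_zero_iff.1 h
    exact (hP _ _ h3).trans ((hf _ _ (hsupp.eq_off h4)).trans (hP _ _ h2))
  refine hfg (key ?_)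
  rw [← hO, encoding_conj_apply]
  simp [hg, IsPhysical.zero, pattern_zero, bulkLocal, amplitude_ne_zero]
  exact hx

/-! ### Sufficient conditions for recovery -/

theorem IsPhysical.sum {ι : Type*} (s : Finset ι) (g : ι → Config n)
    (h : ∀ i ∈ s, IsPhysical (g i)) : IsPhysical (∑ i ∈ s, g i) :=
  Finset.sum_induction g IsPhysical (fun _ _ => .add) .zero h

/-- The configuration of gates around the hole `x` that shifts its label by `v`. -/
def shift (x : Hole n) (v : Label) : Config n := v.1 • gate x 0 + (v.1 + v.2) • gate x 1

theorem isPhysical_shift (x : Hole n) (v : Label) : IsPhysical (shift x v) := by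
  have : ∀ (a : ZMod 2) (c : Fin 3), IsPhysical (a • gate x c) := by
    intro a c
    obtain rfl | rfl : a = 0 ∨ a = 1 := by
      clear * -
      decide +revert
    · rw [zero_smul]
      exact .zero
    · rw [one_smul]
      exact isPhysical_gate x c
  exact (this _ _).add (this _ _)

/-- The coefficients in `shift` solve `a (1, 1) + b (0, 1) = v`. Two of the three joints thus
generate all shifts. -/
theorem pattern_shift (x y : Hole n) (v : Label) :
    pattern (shift x v) y = if y = x then v else 0 := by
  have : ∀ (a : ZMod 2) (c : Fin 3), pattern (a • gate x c) y =
      a • if y = x then gateLabel c else 0 := by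
    intro a c
    obtain rfl | rfl : a = 0 ∨ a = 1 := by
      clear * -
      decide +revert
    · simp [pattern_zero]
    · simp [pattern_gate]
  rw [shift, pattern_add, Pi.add_apply, this, this]
  split_ifs
  · clear * -
    decide +revert
  · simp

theorem exists_isPhysical_pattern_eq (β : BulkConfig n) :
    ∃ g : Config n, IsPhysical g ∧ pattern g = β := by
  refine ⟨∑ x, shift x (β x), .sum _ _ fun x _ => isPhysical_shift x _, ?_⟩
  let φ : Config n →+ BulkConfig n := AddMonoidHom.mk' pattern pattern_add
  change φ _ = β
  rw [map_sum]
  funext y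
  rw [Finset.sum_apply]
  simp [φ, pattern_shift]

/-- Translation by a physical configuration matches any fibre of `pattern` with the fibre of `0`, so
all columns have the same norm. Its value is irrelevant: `recovers_of_label` divides by `c`. -/
theorem exists_conjTranspose_encoding_mul (n : ℕ) :
    ∃ c : ℂ, c ≠ 0 ∧ (encoding n)ᴴ * encoding n = c • 1 := by
  classical
  let F : BulkConfig n → Finset (Config n) := fun β =>
    Finset.univ.filter fun α => IsPhysical α ∧ pattern α = β
  have hF : ∀ β, (F β).card = (F 0).card := by
    intro β
    obtain ⟨g, hg, rfl⟩ := exists_isPhysical_pattern_eq β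
    refine Finset.card_bij (fun α _ => α + g) ?_ ?_ ?_
    · intro α hα
      simp only [F, Finset.mem_filter, Finset.mem_univ, true_and] at hα ⊢
      exact ⟨hα.1.add hg, by rw [pattern_add, hα.2, ← pattern_add, config_add_self, pattern_zero]⟩
    · intro α _ α' _ h
      exact add_right_cancel h
    · intro α hα
      simp only [F, Finset.mem_filter, Finset.mem_univ, true_and] at hα
      refine ⟨α + g, ?_, by rw [add_assoc, config_add_self, add_zero]⟩
      simp only [F, Finset.mem_filter, Finset.mem_univ, true_and]
      exact ⟨hα.1.add hg, by rw [pattern_add, hα.2, zero_add]⟩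
  refine ⟨(F 0).card * (amplitude n * amplitude n), ?_, ?_⟩
  · refine mul_ne_zero (Nat.cast_ne_zero.2 (Finset.card_ne_zero_of_mem (a := 0) ?_))
      (mul_ne_zero (amplitude_ne_zero n) (amplitude_ne_zero n))
    simp [F, IsPhysical.zero, pattern_zero]
  · ext β β'
    rw [Matrix.mul_apply, Matrix.smul_apply, Matrix.one_apply, smul_eq_mul, mul_ite, mul_one,
      mul_zero]
    have e : ∀ α, (encoding n)ᴴ β α * encoding n α β' =
        if IsPhysical α ∧ pattern α = β then (if β = β' then amplitude n * amplitude n else 0)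
          else 0 := by
      intro α
      rw [Matrix.conjTranspose_apply, encoding_apply, encoding_apply, apply_ite star, star_zero,
        star_amplitude]
      by_cases h : IsPhysical α ∧ pattern α = β
      · simp only [h, true_and, if_true, mul_ite, mul_zero]
      · simp [h]
    simp only [e]
    rw [← Finset.sum_filter, Finset.sum_const, hF]
    split_ifs <;> simp

/-- The operator that acts as `o` on the label `f` read off a configuration, by means of the
shifts of the bulk qudit `x`. -/
noncomputable def labelOp (x : Hole n) (f : Config n → Label) (o : Matrix Label Label ℂ) :
    Matrix (Config n) (Config n) ℂ :=
  Matrix.of fun α α' => if α' = α + shift x (f α + f α') then o (f α) (f α') else 0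

theorem labelOp_conjTranspose (x : Hole n) (f : Config n → Label) (o : Matrix Label Label ℂ) :
    (labelOp x f o)ᴴ = labelOp x f oᴴ := by
  ext α α'
  simp only [labelOp, Matrix.conjTranspose_apply, Matrix.of_apply, apply_ite star, star_zero]
  refine if_congr ?_ rfl rfl
  rw [add_comm (f α')]
  generalize shift x (f α + f α') = g
  constructor <;> rintro rfl <;> rw [add_assoc, config_add_self, add_zero]

theorem labelOp_mul_encoding {x : Hole n} {f : Config n → Label}
    (hf : ∀ α, IsPhysical α → f α = pattern α x) (o : Matrix Label Label ℂ) :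
    labelOp x f o * encoding n = encoding n * bulkLocal x o := by
  classical
  ext α β
  rw [encoding_mul_apply, Matrix.mul_apply]
  by_cases hα : IsPhysical α
  · rw [if_pos hα]
    have hα' : IsPhysical (α + shift x (pattern α x + β x)) := hα.add (isPhysical_shift _ _)
    have hp : ∀ y, pattern (α + shift x (pattern α x + β x)) y =
        if y = x then β x else pattern α y := by
      intro y
      rw [pattern_add, Pi.add_apply, pattern_shift]
      split_ifs with h
      · rw [h, ← add_assoc, label_add_self, zero_add]
      · rw [add_zero]
    -- The label at `x` after the move must be `β x`, which leaves one possible intermediate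
    -- configuration.
    rw [Finset.sum_eq_single (α + shift x (pattern α x + β x))]
    · have hf' : f (α + shift x (pattern α x + β x)) = β x := by
        rw [hf _ hα', hp, if_pos rfl]
      have hiff : pattern (α + shift x (pattern α x + β x)) = β ↔ ∀ y, y ≠ x → pattern α y = β y := by
        rw [funext_iff]
        refine forall_congr' fun y => ?_
        rw [hp]
        by_cases h : y = x <;> simp [h]
      rw [labelOp, Matrix.of_apply, hf', hf α hα, if_pos rfl, encoding_apply, bulkLocal,
        Matrix.of_apply]
      simp only [hα', true_and, hiff]
      split_ifs <;> ring
    · intro γ _ hγ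
      rw [labelOp, Matrix.of_apply, encoding_apply]
      by_cases h : IsPhysical γ ∧ pattern γ = β
      · rw [hf α hα, hf γ h.1, h.2, if_neg hγ, zero_mul]
      · rw [if_neg h, mul_zero]
    · simp
  · rw [if_neg hα]
    refine Finset.sum_eq_zero fun γ _ => ?_
    rw [labelOp, Matrix.of_apply, encoding_apply]
    by_cases h : IsPhysical γ ∧ γ = α + shift x (f α + f γ)
    · exact absurd ((isPhysical_shift x _).of_add (h.2 ▸ h.1)) hα
    · rw [not_and_or] at h
      rcases h with h | h <;> simp [h]

theorem supportedOn_labelOp {A : Finset (Qudit n)} {x : Hole n} {f : Config n → Label}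
    (hf : ∀ α α', (∀ q ∈ A, α q = α' q) → f α = f α') (hA : ∀ v, ∀ q, q ∉ A → shift x v q = 0)
    (o : Matrix Label Label ℂ) : SupportedOn A (labelOp x f o) := by
  classical
  let ext : (A → Label) → Config n := fun a q => if h : q ∈ A then a ⟨q, h⟩ else 0
  have hext : ∀ (α : Config n), ∀ q ∈ A, ext (fun q => α q) q = α q := fun α q hq => by
    simp [ext, hq]
  refine ⟨Matrix.of fun a a' => labelOp x f o (ext a) (ext a'), fun α α' => ⟨fun h => ?_, ?_⟩⟩
  · rw [Matrix.of_apply, labelOp, Matrix.of_apply, Matrix.of_apply,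
      hf _ _ (hext α), hf _ _ (hext α')]
    refine if_congr ?_ rfl rfl
    rw [funext_iff, funext_iff]
    refine forall_congr' fun q => ?_
    rw [Pi.add_apply, Pi.add_apply]
    by_cases hq : q ∈ A
    · rw [hext α q hq, hext α' q hq]
    · simp [ext, hq, hA _ q hq, h q hq]
  · intro h
    rw [labelOp, Matrix.of_apply, if_neg]
    intro e
    refine h fun q hq => ?_
    rw [e, Pi.add_apply, hA _ q hq, add_zero]

theorem bulkLocal_conjTranspose (x : Hole n) (o : Matrix Label Label ℂ) :
    (bulkLocal x o)ᴴ = bulkLocal x oᴴ := by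
  ext β β'
  simp only [bulkLocal, Matrix.conjTranspose_apply, Matrix.of_apply, apply_ite star, star_zero]
  exact if_congr (by simp only [eq_comm]) rfl rfl

theorem bulkLocal_smul (x : Hole n) (c : ℂ) (o : Matrix Label Label ℂ) :
    bulkLocal x (c • o) = c • bulkLocal x o := by
  ext β β'
  simp [bulkLocal]

/-- A region from which the label of `x` can be read off, and on which it can be shifted,
recovers `x`. -/
theorem recovers_of_label {A : Finset (Qudit n)} {x : Hole n} {f : Config n → Label}
    (hf : ∀ α α', (∀ q ∈ A, α q = α' q) → f α = f α')
    (hp : ∀ α, IsPhysical α → f α = pattern α x)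
    (hA : ∀ v, ∀ q, q ∉ A → shift x v q = 0) : Recovers A x := by
  rintro _ ⟨o, rfl⟩
  obtain ⟨c, hc, hR⟩ := exists_conjTranspose_encoding_mul n
  -- Intertwining with the encoding on both sides gives the commutation with `codeProj n`; the
  -- second side is the adjoint of the first.
  have h1 := labelOp_mul_encoding hp (c⁻¹ • o)
  have h2 : (encoding n)ᴴ * labelOp x f (c⁻¹ • o) =
      bulkLocal x (c⁻¹ • o) * (encoding n)ᴴ := by
    have := congrArg Matrix.conjTranspose (labelOp_mul_encoding hp (c⁻¹ • o)ᴴ)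
    rwa [Matrix.conjTranspose_mul, Matrix.conjTranspose_mul, labelOp_conjTranspose,
      bulkLocal_conjTranspose, Matrix.conjTranspose_conjTranspose] at this
  refine ⟨labelOp x f (c⁻¹ • o), supportedOn_labelOp hf hA _, ?_, ?_⟩
  · rw [codeProj, ← Matrix.mul_assoc, h1, Matrix.mul_assoc, Matrix.mul_assoc, h2]
  · have h3 : codeProj n * labelOp x f (c⁻¹ • o) =
        encoding n * bulkLocal x (c⁻¹ • o) * (encoding n)ᴴ := by
      rw [codeProj, Matrix.mul_assoc, h2, Matrix.mul_assoc]
    rw [h3, codeProj, Matrix.mul_assoc, ← Matrix.mul_assoc (encoding n)ᴴ, hR, bulkLocal_smul]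
    simp [smul_smul, hc]

/-! ### The qudits on the laterals -/

/-- The qudits along the lateral opposite to the corner `j`. -/
def latSet : (n : ℕ) → Fin 3 → Finset (Qudit n)
  | 0, _ => Finset.univ
  | n + 1, j => (latSet n 0).image (fun q => (Fin.cons (j + 1) q : Qudit (n + 1))) ∪
      (latSet n 2).image (fun q => (Fin.cons (j - 1) q : Qudit (n + 1)))

theorem card_latSet_le (n : ℕ) (j : Fin 3) : (latSet n j).card ≤ 2 ^ n := by
  induction n generalizing j with
  | zero => simp [latSet]
  | succ n ih =>
    rw [pow_succ, mul_two]
    exact (Finset.card_union_le _ _).trans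
      (add_le_add (Finset.card_image_le.trans (ih 0)) (Finset.card_image_le.trans (ih 2)))

theorem cons_mem_latSet_succ {j : Fin 3} {q : Qudit n} (hq : q ∈ latSet n 0) :
    (Fin.cons (j + 1) q : Qudit (n + 1)) ∈ latSet (n + 1) j :=
  Finset.mem_union_left _ (Finset.mem_image_of_mem _ hq)

theorem cons_mem_latSet_pred {j : Fin 3} {q : Qudit n} (hq : q ∈ latSet n 2) :
    (Fin.cons (j - 1) q : Qudit (n + 1)) ∈ latSet (n + 1) j :=
  Finset.mem_union_right _ (Finset.mem_image_of_mem _ hq)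

theorem cornerQudit_mem_latSet {i j : Fin 3} (h : i ≠ j) : cornerQudit n i ∈ latSet n j := by
  induction n generalizing i j with
  | zero => exact Finset.mem_univ _
  | succ n ih =>
    obtain rfl | rfl : i = j + 1 ∨ i = j - 1 := by
      clear ih
      decide +revert
    · exact cons_mem_latSet_succ (ih (by decide))
    · exact cons_mem_latSet_pred (ih (by decide))

theorem lat_congr {j : Fin 3} {α α' : Config n} (h : ∀ q ∈ latSet n j, α q = α' q) :
    lat j α = lat j α' := by
  induction n generalizing j with
  | zero => rw [lat_level_zero, lat_level_zero, h _ (Finset.mem_univ _)]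
  | succ n ih =>
    rw [lat_succ, lat_succ]
    exact congrArg₂ _ (ih fun q hq => h _ (cons_mem_latSet_succ hq))
      (ih fun q hq => h _ (cons_mem_latSet_pred hq))

/-- Corner `1` separates laterals `0` and `2` along the ring. This is what makes the deformed
laterals below one-sided. -/
theorem ringPos_le_of_mem_latSet (q : Qudit n) :
    (q ∈ latSet n 0 → ringPos (cornerQudit n 1) ≤ ringPos q) ∧
      (q ∈ latSet n 2 → ringPos q ≤ ringPos (cornerQudit n 1)) := by
  induction n with
  | zero => simp [ringPos]
  | succ n ih =>
    have hc : ringPos (cornerQudit (n + 1) 1) = 3 ^ n + ringPos (cornerQudit n 1) := by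
      rw [cornerQudit, ringPos_cons]
      simp
    have hlt := ringPos_lt (cornerQudit n 1)
    rw [hc]
    constructor <;> intro h <;> simp only [latSet, Finset.mem_union, Finset.mem_image] at h <;>
      obtain ⟨p, hp, rfl⟩ | ⟨p, hp, rfl⟩ := h <;> rw [ringPos_cons]
    · have := (ih p).1 hp
      simp
      omega
    · rw [show ((0 - 1 : Fin 3) : ℕ) = 2 from rfl]
      omega
    · rw [show ((2 + 1 : Fin 3) : ℕ) = 0 from rfl]
      have := ringPos_lt p
      omega
    · have := (ih p).2 hp
      rw [show ((2 - 1 : Fin 3) : ℕ) = 1 from rfl]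
      omega

theorem ringPos_cornerQudit_zero_le (n : ℕ) :
    ringPos (cornerQudit n 0) ≤ ringPos (cornerQudit n 2) := by
  cases n with
  | zero => simp [ringPos]
  | succ n =>
    rw [cornerQudit, cornerQudit, ringPos_cons, ringPos_cons]
    simp

/-- The lateral opposite to the corner `1` can be deformed past the corner `0` away from the
positions that precede this corner. -/
theorem exists_lat_eq_of_ge (n : ℕ) : ∃ h : Config n → ZMod 2,
    (∀ α α', (∀ q, ringPos (cornerQudit n 0) ≤ ringPos q → α q = α' q) → h α = h α') ∧
      ∀ α, EvenLoops α → lat 1 α = h α := by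
  cases n with
  | zero =>
    exact ⟨lat 1, fun α α' h => lat_congr fun q _ => h q (by simp [ringPos]), fun _ _ => rfl⟩
  | succ n =>
    have hlt := ringPos_lt (cornerQudit n 1)
    -- In child `0`, lateral `2` is replaced by laterals `0` and `1`, and lateral `1` is then moved
    -- across the central hole.
    refine ⟨fun α => lat 0 (child 0 α) + lat 1 (child 1 α) + lat 1 (child 2 α) + lat 0 (child 2 α),
      fun α α' h => ?_, fun α hα => ?_⟩
    · have hc : ∀ (a : Fin 3) (q : Qudit n),
          ringPos (cornerQudit n 1) ≤ a * 3 ^ n + ringPos q → child a α q = child a α' q := by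
        intro a q hq
        refine h _ ?_
        rw [cornerQudit, ringPos_cons, ringPos_cons]
        simpa using hq
      have h0 : lat 0 (child 0 α) = lat 0 (child 0 α') := lat_congr fun q hq =>
        hc 0 q (by simpa using (ringPos_le_of_mem_latSet q).1 hq)
      have h1 : child 1 α = child 1 α' := funext fun q => hc 1 q (by simp; omega)
      have h2 : child 2 α = child 2 α' := funext fun q => hc 2 q (by simp; omega)
      simp only [h0, h1, h2]
    · have h0 := (hα.2 0).lat_sum
      rw [lat_succ, show (1 : Fin 3) + 1 = 2 from rfl, show (1 : Fin 3) - 1 = 0 from rfl]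
      have e : ∀ u : ZMod 2, u + u = 0 := CharTwo.add_self_eq_zero
      linear_combination h0 + hα.1 - e (lat 1 (child 0 α)) - e (lat 0 (child 0 α)) -
        e (lat 1 (child 1 α)) - e (lat 1 (child 2 α))

/-- The lateral opposite to the corner `1` can be deformed past the corner `2` away from the
positions that follow this corner. -/
theorem exists_lat_eq_of_le (n : ℕ) : ∃ h : Config n → ZMod 2,
    (∀ α α', (∀ q, ringPos q ≤ ringPos (cornerQudit n 2) → α q = α' q) → h α = h α') ∧
      ∀ α, EvenLoops α → lat 1 α = h α := by
  cases n with
  | zero =>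
    exact ⟨lat 1, fun α α' h => lat_congr fun q _ => h q (by simp [ringPos]), fun _ _ => rfl⟩
  | succ n =>
    -- The mirror image: lateral `0` of child `2` is the one replaced.
    refine ⟨fun α => lat 2 (child 0 α) + lat 1 (child 0 α) + lat 1 (child 1 α) + lat 2 (child 2 α),
      fun α α' h => ?_, fun α hα => ?_⟩
    · have hc : ∀ (a : Fin 3) (q : Qudit n),
          a * 3 ^ n + ringPos q ≤ 2 * 3 ^ n + ringPos (cornerQudit n 1) →
            child a α q = child a α' q := by
        intro a q hq
        refine h _ ?_
        rw [cornerQudit, ringPos_cons, ringPos_cons]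
        simpa using hq
      have h0 : child 0 α = child 0 α' := funext fun q => hc 0 q (by
        have := ringPos_lt q
        simp
        omega)
      have h1 : child 1 α = child 1 α' := funext fun q => hc 1 q (by
        have := ringPos_lt q
        simp
        omega)
      have h2 : lat 2 (child 2 α) = lat 2 (child 2 α') := lat_congr fun q hq =>
        hc 2 q (by simpa using (ringPos_le_of_mem_latSet q).2 hq)
      simp only [h0, h1, h2]
    · have h2 := (hα.2 2).lat_sum
      rw [lat_succ, show (1 : Fin 3) + 1 = 2 from rfl, show (1 : Fin 3) - 1 = 0 from rfl]
      have e : ∀ u : ZMod 2, u + u = 0 := CharTwo.add_self_eq_zero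
      linear_combination h2 + hα.1 - e (lat 1 (child 0 α)) - e (lat 1 (child 2 α)) -
        e (lat 1 (child 1 α)) - e (lat 2 (child 2 α))

/-! ### The block around a hole -/

/-- The block whose central hole is `x`: its three children are blocks of level `rank`. -/
structure Frame (x : Hole n) where
  rank : ℕ
  base : ℕ
  emb : Fin 3 → Qudit rank → Qudit n
  push : Fin 3 → Config rank → Config n
  level : x.depth + rank + 1 = n
  emb_inj : ∀ c q c' q', emb c q = emb c' q' → c = c' ∧ q = q'
  ringPos_emb : ∀ c q, ringPos (emb c q) = base + (c * 3 ^ rank + ringPos q)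
  base_add_le : base + 3 * 3 ^ rank ≤ 3 ^ n
  push_add : ∀ c α β, push c (α + β) = push c α + push c β
  push_eq_zero : ∀ c α q, (∀ p, emb c p = q → α p = 0) → push c α q = 0
  isPhysical_push : ∀ c α, IsPhysical α → IsPhysical (push c α)
  pattern_push : ∀ c α, IsPhysical α → pattern (push c α) x = 0
  gate_eq : ∀ c, gate x c = push c (corner rank 2) + push (c + 1) (corner rank 0)
  pattern_eq : ∀ α, pattern α x = (lat 1 fun q => α (emb 0 q), lat 1 fun q => α (emb 1 q))
  evenLoops_emb : ∀ α, EvenLoops α → ∀ c, EvenLoops fun q => α (emb c q)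
  lat_sum : ∀ α, EvenLoops α →
    (lat 1 fun q => α (emb 0 q)) + (lat 1 fun q => α (emb 1 q)) + (lat 1 fun q => α (emb 2 q)) = 0

/-- All the data live inside the block, so enclosing it in a larger block only prefixes addresses
and translates ring positions. -/
theorem Hole.nonempty_frame (x : Hole n) : Nonempty (Frame x) := by
  induction n, x using Hole.rec_succ with
  | center n =>
    exact ⟨{
      rank := n
      base := 0
      emb := fun c q => Fin.cons c q
      push := inChild
      level := by simp [Hole.depth, Hole.center]
      emb_inj := fun c q c' q' h => Fin.cons_inj.1 h
      ringPos_emb := fun c q => by rw [ringPos_cons, zero_add]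
      base_add_le := by rw [pow_succ]; omega
      push_add := inChild_add
      push_eq_zero := fun c α q h => by
        by_cases hq : q 0 = c
        · rw [inChild, if_pos hq]
          exact h _ (by rw [← hq, Fin.cons_self_tail])
        · rw [inChild, if_neg hq]
      isPhysical_push := fun c α h => h.inChild c
      pattern_push := fun c α h => by
        rw [pattern_center, child_inChild, child_inChild]
        split_ifs <;> simp [h.lat_eq_zero, lat_zero]
      gate_eq := gate_center n
      pattern_eq := pattern_center
      evenLoops_emb := fun α h => h.2
      lat_sum := fun α h => h.1 }⟩
  | inner n a x ih =>
    obtain ⟨F⟩ := ih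
    exact ⟨{
      rank := F.rank
      base := a * 3 ^ n + F.base
      emb := fun c q => Fin.cons a (F.emb c q)
      push := fun c α => inChild a (F.push c α)
      level := by
        have := F.level
        simp only [Hole.depth, Hole.inner]
        omega
      emb_inj := fun c q c' q' h => F.emb_inj _ _ _ _ (Fin.cons_inj.1 h).2
      ringPos_emb := fun c q => by rw [ringPos_cons, F.ringPos_emb, add_assoc]
      base_add_le := by
        have h := F.base_add_le
        have h0 : (a : ℕ) ≤ 2 := by omega
        have : (a : ℕ) * 3 ^ n ≤ 2 * 3 ^ n := Nat.mul_le_mul_right _ h0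
        rw [pow_succ]
        omega
      push_add := fun c α β => by rw [F.push_add, inChild_add]
      push_eq_zero := fun c α q h => by
        by_cases hq : q 0 = a
        · rw [inChild, if_pos hq]
          exact F.push_eq_zero _ _ _ fun p hp => h p (by rw [hp, ← hq, Fin.cons_self_tail])
        · rw [inChild, if_neg hq]
      isPhysical_push := fun c α h => (F.isPhysical_push c α h).inChild a
      pattern_push := fun c α h => by
        rw [pattern_inner, child_inChild, if_pos rfl, F.pattern_push c α h]
      gate_eq := fun c => by rw [gate_inner, F.gate_eq, inChild_add]
      pattern_eq := fun α => by
        rw [pattern_inner, F.pattern_eq]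
        rfl
      evenLoops_emb := fun α h => F.evenLoops_emb _ (h.2 a)
      lat_sum := fun α h => F.lat_sum _ (h.2 a) }⟩

/-! ### Bounds in the block around a hole -/

namespace Frame

variable {x : Hole n} (F : Frame x) {A : Finset (Qudit n)}

theorem gate_eq_zero {c : Fin 3} {q : Qudit n} (h2 : q ≠ F.emb c (cornerQudit F.rank 2))
    (h0 : q ≠ F.emb (c + 1) (cornerQudit F.rank 0)) : gate x c q = 0 := by
  have key : ∀ (c j : Fin 3), q ≠ F.emb c (cornerQudit F.rank j) →
      F.push c (corner F.rank j) q = 0 := by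
    intro c j h
    refine F.push_eq_zero _ _ _ fun p hp => ?_
    rw [corner, Pi.single_eq_of_ne]
    rintro rfl
    exact h hp.symm
  rw [F.gate_eq, Pi.add_apply, key _ _ h2, key _ _ h0, add_zero]

/-- A region that recovers `x` blocks the deformed gates around `x`. -/
theorem not_avoids_of_recovers (hA : Recovers A x) (c : Fin 3) {s t : Config F.rank}
    (hs : IsPhysical (s + corner F.rank 2)) (ht : IsPhysical (t + corner F.rank 0))
    (hsA : ∀ q, F.emb c q ∈ A → s q = 0) (htA : ∀ q, F.emb (c + 1) q ∈ A → t q = 0) : False := by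
  have e : F.push c s + F.push (c + 1) t =
      gate x c + (F.push c (s + corner F.rank 2) + F.push (c + 1) (t + corner F.rank 0)) := by
    have d1 := config_add_self (F.push c (corner F.rank 2))
    have d2 := config_add_self (F.push (c + 1) (corner F.rank 0))
    rw [F.gate_eq, F.push_add, F.push_add]
    linear_combination (-1 : ℤ) • (d1 + d2)
  refine not_recovers_of_shift (g := F.push c s + F.push (c + 1) t) ?_ ?_ ?_ hA
  · rw [e]
    exact (isPhysical_gate x c).add ((F.isPhysical_push _ _ hs).add (F.isPhysical_push _ _ ht))
  · intro q hq
    rw [Pi.add_apply, F.push_eq_zero _ _ _ fun p hp => hsA p (hp ▸ hq),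
      F.push_eq_zero _ _ _ fun p hp => htA p (hp ▸ hq), add_zero]
  · rw [e, pattern_add, pattern_add, Pi.add_apply, Pi.add_apply, F.pattern_push _ _ hs,
      F.pattern_push _ _ ht, pattern_gate, if_pos rfl]
    clear * -
    decide +revert

/-- A region that recovers `x` meets every deformation of a lateral around `x`. -/
theorem exists_mem_of_recovers (hA : Recovers A x) (c : Fin 3) {S : Qudit F.rank → Prop}
    {h : Config F.rank → ZMod 2} (hS : ∀ α α', (∀ q, S q → α q = α' q) → h α = h α')
    (hlat : ∀ α, EvenLoops α → lat 1 α = h α) : ∃ q, S q ∧ F.emb c q ∈ A := by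
  by_contra! hAS
  let f : Config n → ZMod 2 := fun α => h fun q => α (F.emb c q)
  have hf : ∀ α, IsPhysical α → f α = lat 1 fun q => α (F.emb c q) := fun α hα =>
    (hlat _ (F.evenLoops_emb _ hα.evenLoops c)).symm
  -- The label records only laterals `0` and `1`; the even loop makes the third their sum. The gate
  -- at joint `c` flips the lateral of child `c`.
  have hval : ∀ α, IsPhysical α → f α = ![(pattern α x).1, (pattern α x).2,
      (pattern α x).1 + (pattern α x).2] c := by
    intro α hα
    have hsum := F.lat_sum _ hα.evenLoops
    rw [hf α hα, F.pattern_eq]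
    have t : ∀ u v w : ZMod 2, u + v + w = 0 → w = u + v := by decide
    fin_cases c
    · rfl
    · rfl
    · exact t _ _ _ hsum
  refine not_recovers_of_phase (isPhysical_gate x c) (fun y hy => ?_) f (fun α α' hα => ?_)
    (fun α α' hα hα' e => ?_) ?_ hA
  · rw [pattern_gate, if_neg hy]
  · exact hS _ _ fun q hq => hα _ (hAS q hq)
  · rw [hval α hα, hval α' hα', e]
  · rw [hval _ (isPhysical_gate x c), hval 0 .zero, pattern_zero, pattern_gate, if_pos rfl,
      Pi.zero_apply]
    have key : ∀ c, ![(gateLabel c).1, (gateLabel c).2, (gateLabel c).1 + (gateLabel c).2] c ≠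
        ![(0 : Label).1, (0 : Label).2, (0 : Label).1 + (0 : Label).2] c := by
      decide
    exact key c

/-- The children with at least `2 ^ F.rank` qudits of `A` form a vertex cover of the triangle of
joints, so there are two of them. -/
theorem card_ge_of_recovers (hA : Recovers A x) : 2 * 2 ^ F.rank + 1 ≤ A.card := by
  let B : Fin 3 → Finset (Qudit F.rank) := fun c => Finset.univ.filter fun q => F.emb c q ∈ A
  have hB : (B 0).card + (B 1).card + (B 2).card ≤ A.card := by
    have := sum_card_preimage_le F.emb F.emb_inj A
    rwa [Fin.sum_univ_three] at this
  have mem : ∀ c q, F.emb c q ∈ A → q ∈ B c := fun c q hq => by simpa [B] using hq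
  have hpos : ∀ c, 1 ≤ (B c).card := by
    intro c
    obtain ⟨q, -, hq⟩ := F.exists_mem_of_recovers hA c (S := fun _ => True) (h := lat 1)
      (fun α α' h => lat_congr fun q _ => h q trivial) fun _ _ => rfl
    exact Finset.card_pos.2 ⟨q, mem c q hq⟩
  have hjoint : ∀ c, 2 ^ F.rank ≤ (B c).card ∨ 2 ^ F.rank ≤ (B (c + 1)).card := by
    intro c
    by_contra! h
    obtain ⟨s, hs, hs'⟩ := exists_deformed_corner _ h.1 2
    obtain ⟨t, ht, ht'⟩ := exists_deformed_corner _ h.2 0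
    exact F.not_avoids_of_recovers hA c hs' ht' (fun q hq => hs q (mem _ q hq))
      fun q hq => ht q (mem _ q hq)
  have h0 := hpos 0
  have h1 := hpos 1
  have h2 := hpos 2
  have j0 : 2 ^ F.rank ≤ (B 0).card ∨ 2 ^ F.rank ≤ (B 1).card := hjoint 0
  have j1 : 2 ^ F.rank ≤ (B 1).card ∨ 2 ^ F.rank ≤ (B 2).card := hjoint 1
  have j2 : 2 ^ F.rank ≤ (B 2).card ∨ 2 ^ F.rank ≤ (B 0).card := hjoint 2
  omega

/-- A region recovers `x` if it contains two joints around `x` and deformations of two of its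
laterals. -/
theorem recovers {S : Fin 2 → Qudit F.rank → Prop} {h : Fin 2 → Config F.rank → ZMod 2}
    (hS : ∀ i α α', (∀ q, S i q → α q = α' q) → h i α = h i α')
    (hlat : ∀ i α, EvenLoops α → lat 1 α = h i α)
    (hSA : ∀ i q, S i q → F.emb i.castSucc q ∈ A)
    (h0 : F.emb 0 (cornerQudit F.rank 2) ∈ A) (h1 : F.emb 1 (cornerQudit F.rank 0) ∈ A)
    (h2 : F.emb 1 (cornerQudit F.rank 2) ∈ A) (h3 : F.emb 2 (cornerQudit F.rank 0) ∈ A) :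
    Recovers A x := by
  refine recovers_of_label (f := fun α =>
    (h 0 fun q => α (F.emb 0 q), h 1 fun q => α (F.emb 1 q))) ?_ ?_ ?_
  · intro α α' e
    have e0 := hS 0 (fun q => α (F.emb 0 q)) (fun q => α' (F.emb 0 q)) fun q hq =>
      e _ (hSA 0 q hq)
    have e1 := hS 1 (fun q => α (F.emb 1 q)) (fun q => α' (F.emb 1 q)) fun q hq =>
      e _ (hSA 1 q hq)
    simp only [e0, e1]
  · intro α hα
    rw [F.pattern_eq, hlat 0 _ (F.evenLoops_emb _ hα.evenLoops 0),
      hlat 1 _ (F.evenLoops_emb _ hα.evenLoops 1)]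
  · intro v q hq
    have g0 : gate x 0 q = 0 := F.gate_eq_zero (fun e => hq (e ▸ h0)) fun e => hq (e ▸ h1)
    have g1 : gate x 1 q = 0 := F.gate_eq_zero (fun e => hq (e ▸ h2)) fun e => hq (e ▸ h3)
    simp [shift, g0, g1]

/-- The laterals of children `0` and `1` contain joint `0` and half of joint `1`; the extra qudit is
the other half. -/
theorem exists_recovers_card_le : ∃ A, Recovers A x ∧ A.card ≤ 2 * 2 ^ F.rank + 1 := by
  have c20 : cornerQudit F.rank 2 ∈ latSet F.rank 1 := cornerQudit_mem_latSet (by decide)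
  have c01 : cornerQudit F.rank 0 ∈ latSet F.rank 1 := cornerQudit_mem_latSet (by decide)
  refine ⟨insert (F.emb 2 (cornerQudit F.rank 0))
    ((latSet F.rank 1).image (F.emb 0) ∪ (latSet F.rank 1).image (F.emb 1)), ?_, ?_⟩
  · have m0 : ∀ q ∈ latSet F.rank 1, F.emb 0 q ∈ insert (F.emb 2 (cornerQudit F.rank 0))
        ((latSet F.rank 1).image (F.emb 0) ∪ (latSet F.rank 1).image (F.emb 1)) := fun q hq =>
      Finset.mem_insert_of_mem (Finset.mem_union_left _ (Finset.mem_image_of_mem _ hq))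
    have m1 : ∀ q ∈ latSet F.rank 1, F.emb 1 q ∈ insert (F.emb 2 (cornerQudit F.rank 0))
        ((latSet F.rank 1).image (F.emb 0) ∪ (latSet F.rank 1).image (F.emb 1)) := fun q hq =>
      Finset.mem_insert_of_mem (Finset.mem_union_right _ (Finset.mem_image_of_mem _ hq))
    refine F.recovers (S := fun _ q => q ∈ latSet F.rank 1) (h := fun _ => lat 1)
      (fun i α α' h => lat_congr h) (fun _ _ _ => rfl) ?_ (m0 _ c20) (m1 _ c01) (m1 _ c20)
      (Finset.mem_insert_self _ _)
    intro i
    fin_cases i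
    exacts [m0, m1]
  · have b := card_latSet_le F.rank 1
    have b0 := Finset.card_image_le (s := latSet F.rank 1) (f := F.emb 0)
    have b1 := Finset.card_image_le (s := latSet F.rank 1) (f := F.emb 1)
    have u := Finset.card_union_le ((latSet F.rank 1).image (F.emb 0))
      ((latSet F.rank 1).image (F.emb 1))
    refine (Finset.card_insert_le _ _).trans ?_
    omega

/-- The arc contains child `1` entirely. It may miss part of the lateral of child `0`, which is
therefore read in its deformed form. -/
theorem exists_connected_recovers : ∃ A, IsConnectedRegion A ∧ Recovers A x ∧
    A.card = 2 * 3 ^ F.rank + 1 := by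
  obtain ⟨a, ha⟩ : ∃ a, a = ringPos (cornerQudit F.rank 0) := ⟨_, rfl⟩
  obtain ⟨b, hb⟩ : ∃ b, b = ringPos (cornerQudit F.rank 2) := ⟨_, rfl⟩
  have hab : a ≤ b := by rw [ha, hb]; exact ringPos_cornerQudit_zero_le _
  have hbM : b < 3 ^ F.rank := hb ▸ ringPos_lt _
  have hle := F.base_add_le
  obtain ⟨h, hS, hlat⟩ := exists_lat_eq_of_ge F.rank
  have e0 : ∀ q, ringPos (F.emb 0 q) = F.base + ringPos q := fun q => by
    rw [F.ringPos_emb]; simp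
  have e1 : ∀ q, ringPos (F.emb 1 q) = F.base + (3 ^ F.rank + ringPos q) := fun q => by
    rw [F.ringPos_emb]; simp
  have e2 : ∀ q, ringPos (F.emb 2 q) = F.base + (2 * 3 ^ F.rank + ringPos q) := fun q => by
    rw [F.ringPos_emb]; simp
  refine ⟨Finset.univ.filter fun q => F.base + a ≤ ringPos q ∧
    ringPos q < F.base + a + (2 * 3 ^ F.rank + 1),
    ⟨F.base + a, 2 * 3 ^ F.rank + 1, fun q => ?_⟩, ?_, ?_⟩
  · simp only [Finset.mem_filter, Finset.mem_univ, true_and]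
    constructor
    · intro hq
      refine ⟨ringPos q - (F.base + a), by omega, ?_⟩
      rw [Nat.add_sub_cancel' hq.1, Nat.mod_eq_of_lt (ringPos_lt q)]
    · rintro ⟨t, ht, e⟩
      rw [Nat.mod_eq_of_lt (by omega)] at e
      omega
  · refine F.recovers (S := ![fun q => ringPos (cornerQudit F.rank 0) ≤ ringPos q, fun _ => True])
      (h := ![h, lat 1]) ?_ ?_ ?_ ?_ ?_ ?_ ?_
    · intro i
      fin_cases i
      · exact hS
      · exact fun α α' h => lat_congr fun q _ => h q trivial
    · intro i
      fin_cases i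
      · exact hlat
      · exact fun _ _ => rfl
    · intro i q
      have := ringPos_lt q
      fin_cases i
      · intro hq
        change _ ≤ _ at hq
        change F.emb 0 q ∈ _
        simp only [Finset.mem_filter, Finset.mem_univ, true_and, e0]
        omega
      · intro _
        change F.emb 1 q ∈ _
        simp only [Finset.mem_filter, Finset.mem_univ, true_and, e1]
        omega
    all_goals
      simp only [Finset.mem_filter, Finset.mem_univ, true_and, e0, e1, e2, ← ha, ← hb]
      omega
  · rw [card_interval (by omega)]
    omega

theorem card_ge_of_connected_recovers (hc : IsConnectedRegion A) (hA : Recovers A x) :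
    2 * 3 ^ F.rank + 1 ≤ A.card := by
  obtain ⟨a, ha⟩ : ∃ a, a = ringPos (cornerQudit F.rank 0) := ⟨_, rfl⟩
  obtain ⟨b, hb⟩ : ∃ b, b = ringPos (cornerQudit F.rank 2) := ⟨_, rfl⟩
  have hab : a ≤ b := by rw [ha, hb]; exact ringPos_cornerQudit_zero_le _
  have hbM : b < 3 ^ F.rank := hb ▸ ringPos_lt _
  have hle := F.base_add_le
  have hge : ∀ c : Fin 3, ∃ p, a ≤ p ∧ p < 3 ^ F.rank ∧
      ∃ q ∈ A, ringPos q = F.base + (c * 3 ^ F.rank + p) := by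
    intro c
    obtain ⟨h, hS, hlat⟩ := exists_lat_eq_of_ge F.rank
    obtain ⟨q, hq, hqA⟩ := F.exists_mem_of_recovers hA c hS hlat
    exact ⟨ringPos q, ha ▸ hq, ringPos_lt q, _, hqA, F.ringPos_emb c q⟩
  have hlow : ∀ c : Fin 3, ∃ p, p ≤ b ∧
      ∃ q ∈ A, ringPos q = F.base + (c * 3 ^ F.rank + p) := by
    intro c
    obtain ⟨h, hS, hlat⟩ := exists_lat_eq_of_le F.rank
    obtain ⟨q, hq, hqA⟩ := F.exists_mem_of_recovers hA c hS hlat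
    exact ⟨ringPos q, hb ▸ hq, _, hqA, F.ringPos_emb c q⟩
  have hjoint : ∀ c : Fin 3, ∃ q ∈ A, ringPos q = F.base + (c * 3 ^ F.rank + b) ∨
      ringPos q = F.base + ((c + 1 : Fin 3) * 3 ^ F.rank + a) := by
    intro c
    by_contra! h
    have key : ∀ (j i : Fin 3), F.emb j (cornerQudit F.rank i) ∉ A →
        ∀ q, F.emb j q ∈ A → corner F.rank i q = 0 := by
      intro j i hj q hq
      rw [corner, Pi.single_eq_of_ne]
      rintro rfl
      exact hj hq
    -- No deformation here: the bare gate already requires one of the two qudits at the joint.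
    refine F.not_avoids_of_recovers hA c (s := corner F.rank 2) (t := corner F.rank 0)
      (by rw [config_add_self]; exact .zero) (by rw [config_add_self]; exact .zero)
      (key c 2 fun hm => (h _ hm).1 ?_) (key (c + 1) 0 fun hm => (h _ hm).2 ?_)
    · rw [F.ringPos_emb, hb]
    · rw [F.ringPos_emb, ha]
  obtain ⟨l, r, hlr, hr, hcase⟩ := hc.cases
  have g0 := hge 0
  have g1 := hge 1
  have g2 := hge 2
  have l0 := hlow 0
  have l1 := hlow 1
  have l2 := hlow 2
  have j0 := hjoint 0
  have j1 := hjoint 1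
  have j2 := hjoint 2
  simp only [show ((0 : Fin 3) : ℕ) = 0 from rfl, show ((1 : Fin 3) : ℕ) = 1 from rfl,
    show ((2 : Fin 3) : ℕ) = 2 from rfl, show ((0 + 1 : Fin 3) : ℕ) = 1 from rfl,
    show ((1 + 1 : Fin 3) : ℕ) = 2 from rfl, show ((2 + 1 : Fin 3) : ℕ) = 0 from rfl]
    at g0 g1 g2 l0 l1 l2 j0 j1 j2
  clear hge hlow hjoint
  obtain ⟨hcard, hmem⟩ | ⟨hcard, hmem⟩ := hcase
  -- Joint `2` puts into the interval either corner `2` of child `2`, at distance at least `2 * 3 ^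
  -- F.rank` from a point of child `0` at or before `b`, or corner `0` of child `0`, equally far
  -- from a point of child `2` at or after `a`.
  · obtain ⟨p, hp, hp', q, hq, e⟩ := g2
    obtain ⟨p', hp2, q', hq', e'⟩ := l0
    obtain ⟨q'', hq'', e''⟩ := j2
    rw [hmem] at hq hq' hq''
    omega
  -- Here the missing positions form a gap `[l, r)`, and each point of `A` lies before or after it.
  -- Joints `0` and `1`, whose two qudits are in ring order, suffice to bound the gap.
  · have G : ∀ C, (∃ p, a ≤ p ∧ p < 3 ^ F.rank ∧ ∃ q ∈ A, ringPos q = F.base + (C + p)) →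
        F.base + C + a < l ∨ r < F.base + C + 3 ^ F.rank := by
      rintro C ⟨p, hp, hp', q, hq, e⟩
      rw [hmem] at hq
      omega
    have L : ∀ C, (∃ p, p ≤ b ∧ ∃ q ∈ A, ringPos q = F.base + (C + p)) →
        F.base + C < l ∨ r ≤ F.base + C + b := by
      rintro C ⟨p, hp, q, hq, e⟩
      rw [hmem] at hq
      omega
    have J : ∀ C D, C + b ≤ D + a → (∃ q ∈ A, ringPos q = F.base + (C + b) ∨
        ringPos q = F.base + (D + a)) → F.base + C + b < l ∨ r ≤ F.base + D + a := by
      rintro C D hCD ⟨q, hq, e⟩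
      rw [hmem] at hq
      omega
    have g0 := G _ g0
    have g1 := G _ g1
    have g2 := G _ g2
    have l0 := L _ l0
    have l1 := L _ l1
    have l2 := L _ l2
    have j0 := J _ _ (by omega) j0
    have j1 := J _ _ (by omega) j1
    omega

end Frame

/-! ### The two prices -/

theorem Frame.isLeast_price {x : Hole n} (F : Frame x) :
    IsLeast (recoverySizes x) (price x) ∧ price x = 2 * 2 ^ F.rank + 1 := by
  obtain ⟨A, hA, hcard⟩ := F.exists_recovers_card_le
  have h : IsLeast (recoverySizes x) (2 * 2 ^ F.rank + 1) := by
    refine ⟨⟨A, hA, hcard.antisymm (F.card_ge_of_recovers hA)⟩, ?_⟩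
    rintro _ ⟨B, hB, rfl⟩
    exact F.card_ge_of_recovers hB
  have e : price x = 2 * 2 ^ F.rank + 1 := h.csInf_eq
  exact ⟨e ▸ h, e⟩

theorem Frame.isLeast_connectedPrice {x : Hole n} (F : Frame x) :
    IsLeast (connectedRecoverySizes x) (connectedPrice x) ∧
      connectedPrice x = 2 * 3 ^ F.rank + 1 := by
  obtain ⟨A, hc, hA, hcard⟩ := F.exists_connected_recovers
  have h : IsLeast (connectedRecoverySizes x) (2 * 3 ^ F.rank + 1) := by
    refine ⟨⟨A, hc, hA, hcard⟩, ?_⟩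
    rintro _ ⟨B, hc, hB, rfl⟩
    exact F.card_ge_of_connected_recovers hc hB
  have e : connectedPrice x = 2 * 3 ^ F.rank + 1 := h.csInf_eq
  exact ⟨e ▸ h, e⟩

theorem mainTheorem6 (n : ℕ) (x : Hole n) :
    -- the price: `p(x) = N₀ / 2 ^ d + 1`, where `N₀ = 2 ^ n` and `d` is the depth of `x`
    (IsLeast (recoverySizes x) (price x) ∧
      (price x : ℝ) = (2 ^ n : ℝ) / 2 ^ x.depth + 1) ∧
    -- the connected price: `p_c(x) = (2 / 3) N / 3 ^ d + 1`, where `N = 3 ^ n`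
    (IsLeast (connectedRecoverySizes x) (connectedPrice x) ∧
      (connectedPrice x : ℝ) = 2 / 3 * ((3 ^ n : ℝ) / 3 ^ x.depth) + 1) ∧
    -- it is `(68 / 100) N / 3 ^ d`, up to a relative error of at most 2 percent
    (x.depth + 4 ≤ n →
      |(connectedPrice x : ℝ) - 68 / 100 * ((3 ^ n : ℝ) / 3 ^ x.depth)| ≤
        2 / 100 * (68 / 100 * ((3 ^ n : ℝ) / 3 ^ x.depth))) := by
  obtain ⟨F⟩ := x.nonempty_frame
  obtain ⟨hp, ep⟩ := F.isLeast_price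
  obtain ⟨hc, ec⟩ := F.isLeast_connectedPrice
  have e2 : (2 ^ n : ℝ) / 2 ^ x.depth = 2 * 2 ^ F.rank := by
    rw [div_eq_iff (by positivity)]
    conv_lhs => rw [← F.level]
    ring
  have e3 : (3 ^ n : ℝ) / 3 ^ x.depth = 3 * 3 ^ F.rank := by
    rw [div_eq_iff (by positivity)]
    conv_lhs => rw [← F.level]
    ring
  have ec' : (connectedPrice x : ℝ) = 2 * 3 ^ F.rank + 1 := by
    rw [ec]
    push_cast
    rfl
  refine ⟨⟨hp, ?_⟩, ⟨hc, ?_⟩, fun hn => ?_⟩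
  · rw [e2, ep]
    push_cast
    rfl
  · rw [e3, ec']
    ring
  -- With `t = 3 ^ F.rank` the claim is `1.9992 t ≤ 2 t + 1 ≤ 2.0808 t`. The upper bound needs `t ≥
  -- 1 / 0.0808`, about `12.4`, so `27` suffices while `9` would not.
  · have hk : (3 : ℝ) ^ 3 ≤ 3 ^ F.rank :=
      pow_le_pow_right₀ (by norm_num) (by have := F.level; omega)
    rw [e3, ec', abs_le]
    constructor <;> linarith
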